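/- Let $d\ge 0$, $c\ge 0$ and $k\ge 1$ be integers. There is a constant $K=K(d,k,c)$ such that for every $n$ and every $c$-fat family $u_1,\dots,u_n$ of bounded subsets ("objects") of $\mathbb{R}^d$, the intersection graph of the family has a $\left(\frac{11}{9}3^k-\frac{2}{3}\right)$-hop spanner with at most $K\,n\,\alpha_k(n)$ edges. Here all hypercubes are axis-aligned and closed; the side length of a bounded object is the side length of its smallest enclosing hypercube; and a family of objects is $c$-fat if for every hypercube $\gamma$ of side length $\ell>0$ there exist at most $c$ points hitting all objects of the family that intersect $\gamma$ and have side length at least $\ell$. The intersection graph has one vertex for each object, and two distinct vertices are adjacent if and only if the objects intersect. A $t$-hop spanner of a graph $G$ is a subgraph $\widehat{G}$ of $G$ such that for every edge $uv$ of $G$ there is a path of at most $t$ edges from $u$ to $v$ in $\widehat{G}$. The functions of the inverse Ackermann hierarchy are $\alpha_0(x)=x/2$, $\alpha_1(x)=\log_2 x$, and, for $k\ge 2$, $\alpha_k(x)$ is the least $i\ge 0$ such that applying $\alpha_{k-1}$ successively $i$ times to $x$ gives a value at most $1$ (so $\alpha_2=\log^*$, $\alpha_3=\log^{**}$, and so on).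 -/

import Mathlib

/-- The inverse Ackermann hierarchy: `α₀(x) = x/2`, `α₁(x) = log₂ x`, and for `k ≥ 2`, `αₖ(x)` is
the least number of times that `αₖ₋₁` has to be applied, starting from `x`, to reach a value `≤ 1`.
So `α₂ = log*`, `α₃ = log**`, and so on. -/
noncomputable def invAck : ℕ → ℝ → ℝ
  | 0 => fun x => x / 2
  | 1 => fun x => Real.logb 2 x
  | k + 2 => fun x => ((sInf {i : ℕ | (invAck (k + 1))^[i] x ≤ 1} : ℕ) : ℝ)

theorem exists_iterate_le_one {f : ℝ → ℝ} (hf : ∀ x, 1 < x → ⌈f x⌉₊ < ⌈x⌉₊) (m : ℕ) :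
    ∀ x : ℝ, ⌈x⌉₊ ≤ m + 1 → ∃ i ≤ m, f^[i] x ≤ 1 := by
  induction m with
  | zero =>
    intro x hx
    exact ⟨0, le_rfl, by simpa using Nat.ceil_le.1 hx⟩
  | succ m ih =>
    intro x hx
    by_cases h : x ≤ 1
    · exact ⟨0, Nat.zero_le _, by simpa using h⟩
    · have h1 := hf x (not_le.1 h)
      obtain ⟨i, hi, hi'⟩ := ih (f x) (by omega)
      exact ⟨i + 1, by omega, by simpa [Function.iterate_succ_apply] using hi'⟩

theorem ceil_invAck_lt (k : ℕ) : ∀ x : ℝ, 1 < x → ⌈invAck (k + 1) x⌉₊ < ⌈x⌉₊ := by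
  induction k with
  | zero =>
    intro x hx
    have h1 : 1 < ⌈x⌉₊ := Nat.lt_ceil.2 (by simpa using hx)
    obtain ⟨m, hm⟩ : ∃ m, ⌈x⌉₊ = m + 1 := ⟨⌈x⌉₊ - 1, by omega⟩
    have h2 : x ≤ (2 : ℝ) ^ m := by
      have h3 : m + 1 ≤ 2 ^ m := Nat.lt_two_pow_self
      have h4 : ((m + 1 : ℕ) : ℝ) ≤ (2 : ℝ) ^ m := by exact_mod_cast h3
      exact (hm ▸ Nat.le_ceil x).trans h4
    have h5 : ⌈invAck (0 + 1) x⌉₊ ≤ m := by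
      refine Nat.ceil_le.2 ?_
      change Real.logb 2 x ≤ m
      rw [Real.logb_le_iff_le_rpow (by norm_num) (by linarith)]
      simpa using h2
    omega
  | succ k ih =>
    intro x hx
    have h1 : 1 < ⌈x⌉₊ := Nat.lt_ceil.2 (by simpa using hx)
    obtain ⟨i, hi, hi'⟩ := exists_iterate_le_one ih (⌈x⌉₊ - 1) x (by omega)
    have h2 : sInf {i : ℕ | (invAck (k + 1))^[i] x ≤ 1} ≤ i := Nat.sInf_le hi'
    change ⌈((sInf {i : ℕ | (invAck (k + 1))^[i] x ≤ 1} : ℕ) : ℝ)⌉₊ < _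
    rw [Nat.ceil_natCast]
    omega

/-- The minimum in the definition of `invAck (k + 2)` is always over a nonempty set. -/
theorem invAck_iterate_nonempty (k : ℕ) (x : ℝ) :
    {i : ℕ | (invAck (k + 1))^[i] x ≤ 1}.Nonempty := by
  obtain ⟨i, -, hi⟩ := exists_iterate_le_one (ceil_invAck_lt k) ⌈x⌉₊ x (by omega)
  exact ⟨i, hi⟩

/-- The closed axis-aligned hypercube in `ℝᵈ` with lowest corner `a` and side length `l`. -/
def hypercube {d : ℕ} (a : Fin d → ℝ) (l : ℝ) : Set (Fin d → ℝ) :=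
  {x | ∀ i, a i ≤ x i ∧ x i ≤ a i + l}

/-- The side length of a bounded object: the side length of its smallest enclosing hypercube. -/
noncomputable def sideLength {d : ℕ} (u : Set (Fin d → ℝ)) : ℝ :=
  sInf {l : ℝ | 0 ≤ l ∧ ∃ a : Fin d → ℝ, u ⊆ hypercube a l}

/-- A collection of objects is `c`-fat if for every hypercube `γ` of side length `l`, there are
(at most) `c` points hitting all objects that intersect `γ` and have side length at least `l`. -/
def IsFat {d : ℕ} {ι : Type*} (c : ℕ) (obj : ι → Set (Fin d → ℝ)) : Prop :=
  ∀ (a : Fin d → ℝ) (l : ℝ), 0 < l →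
    ∃ P : Finset (Fin d → ℝ), P.card ≤ c ∧
      ∀ i, (obj i ∩ hypercube a l).Nonempty → l ≤ sideLength (obj i) → ∃ p ∈ P, p ∈ obj i

/-- The intersection graph of a family of objects: two distinct members are adjacent if and only
if they have a point in common. -/
def intersectionGraph {X ι : Type*} (obj : ι → Set X) : SimpleGraph ι where
  Adj i j := i ≠ j ∧ (obj i ∩ obj j).Nonempty
  symm := ⟨fun i j h => ⟨h.1.symm, by rw [Set.inter_comm]; exact h.2⟩⟩
  loopless := ⟨fun _ h => h.1 rfl⟩

/-- `H` is a `t`-hop spanner of `G`: a subgraph of `G` such that the ends of every edge of `G` are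
joined by a path of at most `t` edges in `H`. -/
def IsHopSpanner {V : Type*} (t : ℝ) (G H : SimpleGraph V) : Prop :=
  H ≤ G ∧ ∀ u v, G.Adj u v → ∃ p : H.Walk u v, p.IsPath ∧ (p.length : ℝ) ≤ t

/-! Shifted dyadic grids reduce the geometry to orders. With `2 * d + 1` suitable shifts, every
nonempty object is contained in a cell of comparable size in all but at most `d` grids, so any two
objects share a good grid (`exists_aligned_cells`). Within one grid, cells are nested or disjoint,
so inclusion of cells is a forest order in which objects that meet are comparable.

A forest order on `n` elements has `O(n αₖ(n))` shortcuts that join comparable elements in `2k`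
monotone steps (`IsForest.shortcutBound_invAck`). The recursion on `k` marks about `n / b` elements
that cut the forest into pieces with fewer than `b` elements below any one. Taking `b = αₖ(m)` pays
for shortcuts of the previous level among the marked elements, at linear cost, and the pieces are
treated again with `b` in place of `m`; `αₖ₊₁(m)` rounds suffice.

A shortcut need not be an edge of the intersection graph. Suppose that `u` and `v` meet and that `z`
lies between them in the order. Then `v` meets the cell of `z` and is not much smaller than it, so
by fatness `v` contains one of boundedly many points attached to `z` (`IsFat.exists_hitting_set`):
it belongs to one of boundedly many cliques at `z`. Walking through representatives of these cliques
turns `j` shortcuts into at most `2 * j - 1` edges (`hopReach_of_shortcuts`). With `j = 2k` this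
gives `4k - 1` hops, which is within the stated bound. -/

/-! ### Forest orders and bounded-step reachability. -/

/-- A strict order in which the elements above any given one form a chain. -/
structure IsForest {V : Type*} (r : V → V → Prop) : Prop where
  irrefl : ∀ x, ¬ r x x
  trans : ∀ x y z, r x y → r y z → r x z
  comparable : ∀ x y z, r x y → r x z → y = z ∨ r y z ∨ r z y

/-- `y` can be reached from `x` by at most `n` steps of the relation `E`. -/
inductive HopReach {V : Type*} (E : V → V → Prop) : ℕ → V → V → Prop
  | refl (n : ℕ) (x : V) : HopReach E n x x
  | head {n : ℕ} {x y z : V} : E x y → HopReach E n y z → HopReach E (n + 1) x z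

namespace HopReach

variable {V : Type*} {E F : V → V → Prop} {m n : ℕ} {x y z : V}

theorem mono (h : HopReach E n x y) (hEF : ∀ a b, E a b → F a b) (hn : n ≤ m) :
    HopReach F m x y := by
  induction h generalizing m with
  | refl n x => exact .refl _ _
  | head h1 _ ih =>
    obtain ⟨m, rfl⟩ : ∃ m', m = m' + 1 := ⟨m - 1, by omega⟩
    exact .head (hEF _ _ h1) (ih (by omega))

theorem trans (h : HopReach E m x y) (h' : HopReach E n y z) : HopReach E (m + n) x z := by
  induction h with
  | refl k x => exact h'.mono (fun _ _ h => h) (by omega)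
  | head h1 _ ih =>
    rw [add_right_comm]
    exact .head h1 (ih h')

theorem single (h : x = y ∨ E x y) : HopReach E 1 x y := by
  rcases h with rfl | h
  · exact .refl _ _
  · exact .head h (.refl 0 _)

theorem eq_or_of_trans (h : HopReach E n x y) (hEF : ∀ a b, E a b → F a b)
    (hF : ∀ a b c, F a b → F b c → F a c) : x = y ∨ F x y := by
  induction h with
  | refl n x => exact .inl rfl
  | head h1 _ ih =>
    rcases ih with rfl | ih
    · exact .inr (hEF _ _ h1)
    · exact .inr (hF _ _ _ (hEF _ _ h1) ih)

end HopReach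

/-! ### Cutting a forest at marked elements. -/

namespace IsForest

variable {V : Type*} {r : V → V → Prop}

/-- The relation `r`, restricted to pairs with no element of `M` between them. -/
def cut (r : V → V → Prop) (M : Finset V) (x y : V) : Prop :=
  r x y ∧ ∀ s ∈ M, ¬ ((x = s ∨ r x s) ∧ (s = y ∨ r s y))

/-- Transitivity is the point: a cut element between `x` and `z` is comparable to the middle element
`y`, because both lie above `x` or one of them equals it; it therefore falls into `[x, y]` or `[y,
z]`. -/
theorem isForest_cut (hr : IsForest r) (M : Finset V) : IsForest (cut r M) where
  irrefl x h := hr.irrefl x h.1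
  trans x y z h1 h2 := by
    refine ⟨hr.trans _ _ _ h1.1 h2.1, fun s hs h => ?_⟩
    rcases h.1 with rfl | h3
    · exact h1.2 _ hs ⟨.inl rfl, .inr h1.1⟩
    · rcases hr.comparable _ _ _ h3 h1.1 with rfl | h4 | h4
      · exact h1.2 _ hs ⟨.inr h1.1, .inl rfl⟩
      · exact h1.2 _ hs ⟨.inr h3, .inr h4⟩
      · exact h2.2 _ hs ⟨.inr h4, h.2⟩
  comparable x y z h1 h2 := by
    rcases hr.comparable _ _ _ h1.1 h2.1 with h | h | h
    · exact .inl h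
    · refine .inr (.inl ⟨h, fun s hs h' => h2.2 s hs ⟨?_, h'.2⟩⟩)
      rcases h'.1 with rfl | h3
      · exact .inr h1.1
      · exact .inr (hr.trans _ _ _ h1.1 h3)
    · refine .inr (.inr ⟨h, fun s hs h' => h1.2 s hs ⟨?_, h'.2⟩⟩)
      rcases h'.1 with rfl | h3
      · exact .inr h2.1
      · exact .inr (hr.trans _ _ _ h2.1 h3)

theorem isForest_restrict (hr : IsForest r) (M : Finset V) :
    IsForest (fun x y => r x y ∧ x ∈ M ∧ y ∈ M) where
  irrefl x h := hr.irrefl x h.1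
  trans x y z h1 h2 := ⟨hr.trans _ _ _ h1.1 h2.1, h1.2.1, h2.2.2⟩
  comparable x y z h1 h2 := by
    rcases hr.comparable _ _ _ h1.1 h2.1 with h | h | h
    · exact .inl h
    · exact .inr (.inl ⟨h, h1.2.2, h2.2.2⟩)
    · exact .inr (.inr ⟨h, h2.2.2, h1.2.2⟩)

open Classical in
/-- The elements of `S` that are equal to `y` or below it. -/
noncomputable def down (r : V → V → Prop) (S : Finset V) (y : V) : Finset V :=
  S.filter fun x => x = y ∨ r x y

/-- The number of elements below `y`, in units of `b`. -/
noncomputable def height (r : V → V → Prop) (S : Finset V) (b : ℝ) (y : V) : ℕ :=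
  ⌊((down r S y).card : ℝ) / b⌋₊

open Classical in
/-- The elements of positive height at which the height increases strictly. -/
noncomputable def marked (r : V → V → Prop) (S : Finset V) (b : ℝ) : Finset V :=
  S.filter fun y => 1 ≤ height r S b y ∧ ∀ x, r x y → height r S b x < height r S b y

open Classical in
/-- The maximal elements of `D`. -/
noncomputable def maximals (r : V → V → Prop) (D : Finset V) : Finset V :=
  D.filter fun x => ∀ z ∈ D, ¬ r x z

variable {S : Finset V} {b : ℝ} {x y z s : V}

theorem mem_down : x ∈ down r S y ↔ x ∈ S ∧ (x = y ∨ r x y) := by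
  simp [down]

theorem mem_marked : y ∈ marked r S b ↔ y ∈ S ∧ 1 ≤ height r S b y ∧
    ∀ x, r x y → height r S b x < height r S b y := by
  simp [marked]

theorem mem_maximals {D : Finset V} : x ∈ maximals r D ↔ x ∈ D ∧ ∀ z ∈ D, ¬ r x z := by
  simp [maximals]

theorem down_subset_self (r : V → V → Prop) (S : Finset V) (y : V) : down r S y ⊆ S :=
  fun _ h => (mem_down.1 h).1

theorem marked_subset (r : V → V → Prop) (S : Finset V) (b : ℝ) : marked r S b ⊆ S :=
  fun _ h => (mem_marked.1 h).1

theorem down_subset (hr : IsForest r) (h : x = y ∨ r x y) : down r S x ⊆ down r S y := by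
  intro a ha
  rw [mem_down] at ha ⊢
  refine ⟨ha.1, ?_⟩
  rcases h with rfl | h
  · exact ha.2
  · rcases ha.2 with rfl | h'
    · exact .inr h
    · exact .inr (hr.trans _ _ _ h' h)

theorem disjoint_down (hr : IsForest r) (h1 : x ≠ y) (h2 : ¬ r x y) (h3 : ¬ r y x) :
    Disjoint (down r S x) (down r S y) := by
  rw [Finset.disjoint_left]
  intro a ha hb
  rw [mem_down] at ha hb
  rcases ha.2 with rfl | h4
  · rcases hb.2 with rfl | h5
    · exact h1 rfl
    · exact h2 h5
  · rcases hb.2 with rfl | h5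
    · exact h3 h4
    · rcases hr.comparable _ _ _ h4 h5 with h | h | h
      · exact h1 h
      · exact h2 h
      · exact h3 h

theorem height_mono (hr : IsForest r) (hb : 0 < b) (h : x = y ∨ r x y) :
    height r S b x ≤ height r S b y := by
  refine Nat.floor_le_floor ?_
  have : (down r S x).card ≤ (down r S y).card := Finset.card_le_card (hr.down_subset h)
  gcongr

theorem exists_mem_maximals (hr : IsForest r) (D : Finset V) :
    ∀ x ∈ D, ∃ c ∈ maximals r D, x = c ∨ r x c := by
  classical
  suffices H : ∀ n : ℕ, ∀ x ∈ D, (D.filter fun z => r x z).card ≤ n →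
      ∃ c ∈ maximals r D, x = c ∨ r x c from fun x hx => H _ x hx le_rfl
  intro n
  induction n with
  | zero =>
    intro x hx h
    refine ⟨x, ?_, .inl rfl⟩
    simp only [Nat.le_zero, Finset.card_eq_zero, Finset.filter_eq_empty_iff] at h
    exact mem_maximals.2 ⟨hx, fun z hz => h hz⟩
  | succ n ih =>
    intro x hx h
    by_cases hm : ∃ z ∈ D, r x z
    · obtain ⟨z, hz, hxz⟩ := hm
      obtain ⟨c, hc, hzc⟩ := ih z hz (by
        refine Nat.lt_succ_iff.1 (lt_of_lt_of_le (Finset.card_lt_card ?_) h)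
        refine Finset.ssubset_iff_subset_ne.2 ⟨fun a ha => ?_, fun he => ?_⟩
        · rw [Finset.mem_filter] at ha ⊢
          exact ⟨ha.1, hr.trans _ _ _ hxz ha.2⟩
        · have : z ∈ D.filter fun a => r z a := by
            rw [he]
            exact Finset.mem_filter.2 ⟨hz, hxz⟩
          exact hr.irrefl z (Finset.mem_filter.1 this).2)
      refine ⟨c, hc, .inr ?_⟩
      rcases hzc with rfl | hzc
      · exact hxz
      · exact hr.trans _ _ _ hxz hzc
    · push Not at hm
      exact ⟨x, by exact mem_maximals.2 ⟨hx, hm⟩, .inl rfl⟩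

/-- A downward closed set is the disjoint union of the parts below its maximal elements. -/
theorem card_inter_eq_sum [DecidableEq V] (hr : IsForest r) {D : Finset V} (hDS : D ⊆ S)
    (hD : ∀ x ∈ D, ∀ z ∈ S, r z x → z ∈ D) (A : Finset V) :
    (D ∩ A).card = ∑ c ∈ maximals r D, (down r S c ∩ A).card := by
  rw [← Finset.card_biUnion]
  · congr 1
    ext a
    simp only [Finset.mem_inter, Finset.mem_biUnion]
    constructor
    · rintro ⟨h1, h2⟩
      obtain ⟨c, hc, hac⟩ := hr.exists_mem_maximals D a h1
      exact ⟨c, hc, mem_down.2 ⟨hDS h1, hac⟩, h2⟩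
    · rintro ⟨c, hc, h1, h2⟩
      refine ⟨?_, h2⟩
      rw [mem_down] at h1
      have hcD := (mem_maximals.1 hc).1
      rcases h1.2 with rfl | h3
      · exact hcD
      · exact hD c hcD a h1.1 h3
  · intro c hc e he hce
    have hc' := mem_maximals.1 hc
    have he' := mem_maximals.1 he
    exact (hr.disjoint_down hce (hc'.2 _ he'.1) (he'.2 _ hc'.1)).mono Finset.inter_subset_left
      Finset.inter_subset_left

theorem mul_height_le (hb : 0 < b) (y : V) : (height r S b y : ℝ) * b ≤ (down r S y).card := by
  rw [← le_div_iff₀ hb]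
  exact Nat.floor_le (by positivity)

theorem card_lt_mul_height (hb : 0 < b) (y : V) :
    ((down r S y).card : ℝ) < (height r S b y + 1) * b := by
  rw [← div_lt_iff₀ hb]
  exact Nat.lt_floor_add_one _

theorem le_height (hb : 0 < b) {n : ℕ} (h : n * b ≤ (down r S y).card) :
    n ≤ height r S b y := by
  rw [height, Nat.le_floor_iff (by positivity), le_div_iff₀ hb]
  exact h

/-- Superadditivity of heights: the sets below distinct maximal elements are disjoint, and rounding
down only helps. -/
theorem sum_height_mul_le (hr : IsForest r) (hb : 0 < b) {D : Finset V} (hDS : D ⊆ S)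
    (hD : ∀ x ∈ D, ∀ z ∈ S, r z x → z ∈ D) :
    ((∑ c ∈ maximals r D, height r S b c : ℕ) : ℝ) * b ≤ D.card := by
  classical
  have h := hr.card_inter_eq_sum hDS hD S
  rw [Finset.inter_eq_left.2 hDS] at h
  rw [h, Nat.cast_sum, Nat.cast_sum, Finset.sum_mul]
  refine Finset.sum_le_sum fun c _ => ?_
  rw [Finset.inter_eq_left.2 (down_subset_self r S c)]
  exact mul_height_le hb c

/-- Same count as for a binary tree with `h` leaves. Let the children of `y` be the maximal elements
strictly below it. With two or more children of positive height, superadditivity leaves room for `y`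
itself; with exactly one, `y` can be marked only if its height exceeds that of the child. The
subtraction is truncated, so height zero allows no marked element. -/
theorem card_down_inter_marked_le [DecidableEq V] (hr : IsForest r) (hb : 0 < b) :
    ∀ n : ℕ, ∀ y ∈ S, (down r S y).card ≤ n →
      (down r S y ∩ marked r S b).card ≤ 2 * height r S b y - 1 := by
  intro n
  induction n with
  | zero =>
    intro y hy h
    have : y ∈ down r S y := mem_down.2 ⟨hy, .inl rfl⟩
    have := Finset.card_pos.2 ⟨y, this⟩
    omega
  | succ n ih =>
    intro y hy hn
    have hyd : y ∈ down r S y := mem_down.2 ⟨hy, .inl rfl⟩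
    set D := (down r S y).erase y with hDdef
    have hmemD : ∀ x, x ∈ D ↔ x ∈ S ∧ r x y := by
      intro x
      rw [hDdef, Finset.mem_erase, mem_down]
      constructor
      · rintro ⟨h1, h2, h3 | h3⟩
        · exact absurd h3 h1
        · exact ⟨h2, h3⟩
      · rintro ⟨h1, h2⟩
        exact ⟨fun h => hr.irrefl y (h ▸ h2), h1, .inr h2⟩
    have hDS : D ⊆ S := fun x hx => ((hmemD x).1 hx).1
    have hD : ∀ x ∈ D, ∀ z ∈ S, r z x → z ∈ D := fun x hx z hz h =>
      (hmemD z).2 ⟨hz, hr.trans _ _ _ h ((hmemD x).1 hx).2⟩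
    have hCy : ∀ c ∈ maximals r D, c ∈ S ∧ r c y := fun c hc =>
      (hmemD c).1 (mem_maximals.1 hc).1
    have hsum : ∑ c ∈ maximals r D, height r S b c ≤ height r S b y := by
      refine le_height hb ((hr.sum_height_mul_le hb hDS hD).trans ?_)
      exact_mod_cast Finset.card_le_card (Finset.erase_subset _ _)
    have hcount : (D ∩ marked r S b).card ≤
        ∑ c ∈ maximals r D, (2 * height r S b c - 1) := by
      rw [hr.card_inter_eq_sum hDS hD]
      refine Finset.sum_le_sum fun c hc => ih c (hCy c hc).1 ?_
      refine Nat.lt_succ_iff.1 (lt_of_lt_of_le (Finset.card_lt_card ?_) hn)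
      refine Finset.ssubset_iff_subset_ne.2 ⟨hr.down_subset (.inr (hCy c hc).2), fun he => ?_⟩
      rw [← he, mem_down] at hyd
      rcases hyd.2 with h | h
      · exact hr.irrefl y (by simpa [← h] using (hCy c hc).2)
      · exact hr.irrefl y (hr.trans _ _ _ h (hCy c hc).2)
    -- Children of height zero contribute nothing; for the others the subtraction is exact and saves
    -- one per child.
    set C := (maximals r D).filter fun c => 1 ≤ height r S b c with hC
    have hsumC : ∑ c ∈ maximals r D, (2 * height r S b c - 1) =
        ∑ c ∈ C, (2 * height r S b c - 1) := by
      rw [hC, Finset.sum_filter]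
      refine Finset.sum_congr rfl fun c _ => ?_
      split_ifs <;> omega
    have hsumC' : ∑ c ∈ C, (2 * height r S b c - 1) + C.card =
        2 * ∑ c ∈ C, height r S b c := by
      rw [Finset.card_eq_sum_ones, ← Finset.sum_add_distrib, Finset.mul_sum]
      refine Finset.sum_congr rfl fun c hc => ?_
      have := (Finset.mem_filter.1 hc).2
      omega
    have hCle : ∑ c ∈ C, height r S b c ≤ ∑ c ∈ maximals r D, height r S b c :=
      Finset.sum_le_sum_of_subset (Finset.filter_subset _ _)
    have hdown : down r S y = insert y D := by
      rw [hDdef, Finset.insert_erase hyd]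
    have hyD : y ∉ D := Finset.notMem_erase _ _
    by_cases hym : y ∈ marked r S b
    · have hcard : (down r S y ∩ marked r S b).card = (D ∩ marked r S b).card + 1 := by
        rw [hdown, Finset.insert_inter_of_mem hym, Finset.card_insert_of_notMem]
        exact fun h => hyD (Finset.mem_inter.1 h).1
      have h2 := (mem_marked.1 hym).2
      rcases Nat.lt_or_ge C.card 1 with h0 | h1
      · have : C = ∅ := Finset.card_eq_zero.1 (by omega)
        rw [this, Finset.sum_empty] at hsumC
        omega
      · rcases Nat.lt_or_ge C.card 2 with h3 | h3
        · obtain ⟨c, hc⟩ := Finset.card_eq_one.1 (show C.card = 1 by omega)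
          rw [hc, Finset.sum_singleton] at hsumC hsumC'
          have hcC : c ∈ C := by rw [hc]; exact Finset.mem_singleton_self c
          have h4 := h2.2 c (hCy c (Finset.mem_filter.1 hcC).1).2
          have h5 := (Finset.mem_filter.1 hcC).2
          omega
        · omega
    · have hcard : (down r S y ∩ marked r S b).card = (D ∩ marked r S b).card := by
        rw [hdown, Finset.insert_inter_of_notMem hym]
      rcases Nat.lt_or_ge C.card 1 with h0 | h1
      · have : C = ∅ := Finset.card_eq_zero.1 (by omega)
        rw [this, Finset.sum_empty] at hsumC
        omega
      · omega

theorem card_marked_mul_le (hr : IsForest r) (hb : 0 < b) :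
    ((marked r S b).card : ℝ) * b ≤ 2 * S.card := by
  classical
  have h1 : (marked r S b).card ≤ 2 * ∑ c ∈ maximals r S, height r S b c := by
    have h := hr.card_inter_eq_sum (S := S) subset_rfl (fun x _ z hz _ => hz) (marked r S b)
    rw [Finset.inter_eq_right.2 (marked_subset r S b)] at h
    rw [h, Finset.mul_sum]
    refine Finset.sum_le_sum fun c hc => ?_
    exact (hr.card_down_inter_marked_le hb _ c (mem_maximals.1 hc).1 le_rfl).trans
      (Nat.sub_le _ _)
  have h2 := hr.sum_height_mul_le (S := S) hb subset_rfl (fun x _ z hz _ => hz)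
  have h3 : ((marked r S b).card : ℝ) ≤
      2 * ((∑ c ∈ maximals r S, height r S b c : ℕ) : ℝ) := by exact_mod_cast h1
  nlinarith

/-- An unmarked element of positive height has one below it of the same height; descend until a
marked one is reached. -/
theorem exists_marked_height_eq (hr : IsForest r) (hS : ∀ x y, r x y → x ∈ S ∧ y ∈ S)
    (hb : 0 < b) : ∀ n : ℕ, ∀ y ∈ S, (down r S y).card ≤ n → 1 ≤ height r S b y →
      ∃ z ∈ marked r S b, (z = y ∨ r z y) ∧ height r S b z = height r S b y := by
  intro n
  induction n with
  | zero =>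
    intro y hy h
    have : y ∈ down r S y := mem_down.2 ⟨hy, .inl rfl⟩
    have := Finset.card_pos.2 ⟨y, this⟩
    omega
  | succ n ih =>
    intro y hy hn h1
    by_cases hym : y ∈ marked r S b
    · exact ⟨y, hym, .inl rfl, rfl⟩
    · have : ∃ x, r x y ∧ height r S b y ≤ height r S b x := by
        by_contra! hcon
        exact hym (mem_marked.2 ⟨hy, h1, hcon⟩)
      obtain ⟨x, hxy, hx⟩ := this
      have hle : height r S b x ≤ height r S b y := hr.height_mono hb (.inr hxy)
      obtain ⟨z, hz, hzx, hh⟩ := ih x (hS _ _ hxy).1 (by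
        refine Nat.lt_succ_iff.1 (lt_of_lt_of_le (Finset.card_lt_card ?_) hn)
        refine Finset.ssubset_iff_subset_ne.2 ⟨hr.down_subset (.inr hxy), fun he => ?_⟩
        have hyd : y ∈ down r S y := mem_down.2 ⟨hy, .inl rfl⟩
        rw [← he, mem_down] at hyd
        rcases hyd.2 with h | h
        · exact hr.irrefl y (by simpa [← h] using hxy)
        · exact hr.irrefl y (hr.trans _ _ _ h hxy)) (by omega)
      refine ⟨z, hz, .inr ?_, by omega⟩
      rcases hzx with rfl | hzx
      · exact hxy
      · exact hr.trans _ _ _ hzx hxy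

/-- A marked element of the same height as `y` is the largest marked element below `y`. -/
theorem marked_le_of_height_eq (hr : IsForest r) (hb : 0 < b)
    (hzy : z = y ∨ r z y) (hh : height r S b z = height r S b y)
    (hs : s ∈ marked r S b) (hsy : s = y ∨ r s y) : s = z ∨ r s z := by
  classical
  by_contra! hcon
  have hs' := mem_marked.1 hs
  by_cases hzs : r z s
  · have h1 := hs'.2.2 z hzs
    have h2 := hr.height_mono (S := S) hb hsy
    omega
  -- If `s` and `z` were incomparable, the heights would add up below `y`, but `z` already has the
  -- full height of `y` and `s` has positive height.
  · have hdisj := hr.disjoint_down (S := S) hcon.1 hcon.2 hzs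
    have hcard := Finset.card_union_of_disjoint hdisj
    have hle : (down r S s ∪ down r S z).card ≤ (down r S y).card :=
      Finset.card_le_card (Finset.union_subset (hr.down_subset hsy) (hr.down_subset hzy))
    have h1 := mul_height_le (r := r) (S := S) hb s
    have h2 := mul_height_le (r := r) (S := S) hb z
    have h3 : height r S b s + height r S b z ≤ height r S b y := by
      refine le_height hb ?_
      have : ((down r S s).card : ℝ) + (down r S z).card ≤ (down r S y).card := by
        exact_mod_cast hcard ▸ hle
      push_cast
      linarith
    have := hs'.2.1
    omega

/-- Elements below `y` need not form a chain, so a largest marked one exists only thanks to the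
choice of the marking. Quantifying over `s` inside makes `z` total in `y`, with an arbitrary value
if nothing marked is below. -/
theorem exists_floor (hr : IsForest r) (hS : ∀ x y, r x y → x ∈ S ∧ y ∈ S) (hb : 0 < b) (y : V) :
    ∃ z, ∀ s ∈ marked r S b, s = y ∨ r s y →
      z ∈ marked r S b ∧ (s = z ∨ r s z) ∧ (z = y ∨ r z y) := by
  by_cases h : ∃ s ∈ marked r S b, s = y ∨ r s y
  · obtain ⟨s, hs, hsy⟩ := h
    have hs' := mem_marked.1 hs
    have hy : y ∈ S := by
      rcases hsy with rfl | h
      · exact hs'.1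
      · exact (hS _ _ h).2
    obtain ⟨z, hz, hzy, hh⟩ := hr.exists_marked_height_eq hS hb _ y hy le_rfl
      (hs'.2.1.trans (hr.height_mono hb hsy))
    exact ⟨z, fun s hs hsy => ⟨hz, hr.marked_le_of_height_eq hb hzy hh hs hsy, hzy⟩⟩
  · push Not at h
    exact ⟨y, fun s hs hsy => absurd hsy (by simpa using h s hs)⟩

theorem exists_ceil (hr : IsForest r) (M : Finset V) (x : V) :
    ∃ z, ∀ s ∈ M, x = s ∨ r x s → z ∈ M ∧ (x = z ∨ r x z) ∧ (z = s ∨ r z s) := by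
  classical
  by_cases h : ∃ s ∈ M, x = s ∨ r x s
  · obtain ⟨s, hs, hxs⟩ := h
    let A := M.filter fun s => x = s ∨ r x s
    -- `A` lies above `x`, hence is a chain, so its reversal is again a forest order; a maximal
    -- element of the reversal is the minimum of `A`.
    have hr' : IsForest fun x y => (r y x ∧ x ∈ A ∧ y ∈ A) := by
      refine ⟨fun x h => hr.irrefl x h.1, fun x y z h1 h2 =>
        ⟨hr.trans _ _ _ h2.1 h1.1, h1.2.1, h2.2.2⟩, fun a y z h1 h2 => ?_⟩
      have hy := (Finset.mem_filter.1 h1.2.2).2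
      have hz := (Finset.mem_filter.1 h2.2.2).2
      rcases hy with rfl | hy
      · rcases hz with rfl | hz
        · exact .inl rfl
        · exact .inr (.inr ⟨hz, h2.2.2, h1.2.2⟩)
      · rcases hz with rfl | hz
        · exact .inr (.inl ⟨hy, h1.2.2, h2.2.2⟩)
        · rcases hr.comparable _ _ _ hy hz with h | h | h
          · exact .inl h
          · exact .inr (.inr ⟨h, h2.2.2, h1.2.2⟩)
          · exact .inr (.inl ⟨h, h1.2.2, h2.2.2⟩)
    obtain ⟨z, hz, -⟩ := hr'.exists_mem_maximals A s (Finset.mem_filter.2 ⟨hs, hxs⟩)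
    obtain ⟨hzA, hzmin⟩ := mem_maximals.1 hz
    have hzA' := Finset.mem_filter.1 hzA
    refine ⟨z, fun t ht hxt => ⟨hzA'.1, hzA'.2, ?_⟩⟩
    have htA : t ∈ A := Finset.mem_filter.2 ⟨ht, hxt⟩
    have hnot : ¬ r t z := fun h => hzmin t htA ⟨h, hzA, htA⟩
    rcases hzA'.2 with h1 | h1
    · exact h1 ▸ hxt
    · rcases hxt with rfl | h2
      · exact absurd h1 hnot
      · rcases hr.comparable _ _ _ h1 h2 with h | h | h
        · exact .inl h
        · exact .inr h
        · exact absurd h hnot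
  · push Not at h
    exact ⟨x, fun s hs hxs => absurd hxs (by simpa using h s hs)⟩

-- Let `z` be marked below `y` with the same height `h`. What remains below `y` after cutting avoids
-- everything below `z`, which leaves fewer than `(h + 1) * b - h * b = b` elements, `y` included.
-- If `h = 0`, there are fewer than `b` to begin with.
open Classical in
theorem card_cut_marked_lt (hr : IsForest r) (hS : ∀ x y, r x y → x ∈ S ∧ y ∈ S) (hb : 0 < b)
    (y : V) : ((S.filter fun x => cut r (marked r S b) x y).card : ℝ) + 1 ≤ max 1 b := by
  set A := S.filter fun x => cut r (marked r S b) x y with hA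
  rcases A.eq_empty_or_nonempty with h0 | ⟨x, hx⟩
  · simp [h0]
  · refine le_max_of_le_right ?_
    have hmem : ∀ x ∈ A, x ∈ S ∧ cut r (marked r S b) x y := fun x hx => Finset.mem_filter.1 hx
    have hxy := (hmem x hx).2
    have hy : y ∈ S := (hS _ _ hxy.1).2
    have hyA : y ∉ A := fun h => hr.irrefl y (hmem y h).2.1
    have hym : y ∉ marked r S b := fun h => hxy.2 y h ⟨.inr hxy.1, .inl rfl⟩
    have hyd : y ∈ down r S y := mem_down.2 ⟨hy, .inl rfl⟩
    have hsub : insert y A ⊆ down r S y := by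
      refine Finset.insert_subset hyd fun a ha => mem_down.2 ⟨(hmem a ha).1, .inr (hmem a ha).2.1⟩
    have hlt := card_lt_mul_height (r := r) (S := S) hb y
    have hcard : ((insert y A).card : ℝ) = A.card + 1 := by
      rw [Finset.card_insert_of_notMem hyA]; push_cast; rfl
    rw [← hcard]
    rcases Nat.eq_zero_or_pos (height r S b y) with h0 | h1
    · rw [h0] at hlt
      have : ((insert y A).card : ℝ) ≤ (down r S y).card := by
        exact_mod_cast Finset.card_le_card hsub
      push_cast at hlt
      linarith
    · obtain ⟨z, hz, hzy, hh⟩ := hr.exists_marked_height_eq hS hb _ y hy le_rfl h1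
      have hdisj : Disjoint (insert y A) (down r S z) := by
        rw [Finset.disjoint_left]
        intro a ha haz
        have haz' := (mem_down.1 haz).2
        rcases Finset.mem_insert.1 ha with rfl | ha
        · rcases haz' with rfl | h
          · exact hym hz
          · rcases hzy with rfl | h'
            · exact hym hz
            · exact hr.irrefl a (hr.trans _ _ _ h h')
        · exact (hmem a ha).2.2 z hz ⟨haz', hzy⟩
      have hle : (insert y A ∪ down r S z).card ≤ (down r S y).card :=
        Finset.card_le_card (Finset.union_subset hsub (hr.down_subset hzy))
      rw [Finset.card_union_of_disjoint hdisj] at hle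
      have hle' : ((insert y A).card : ℝ) + (down r S z).card ≤ (down r S y).card := by
        exact_mod_cast hle
      have := mul_height_le (r := r) (S := S) hb z
      rw [hh] at this
      linarith

-- The elements above `x` form a chain, along which marked elements have distinct positive heights.
open Classical in
theorem card_marked_above_le (hr : IsForest r) {N : ℕ}
    (hN : ∀ y ∈ S, height r S b y ≤ N) (x : V) :
    ((marked r S b).filter fun s => r x s).card ≤ N := by
  have h : ((marked r S b).filter fun s => r x s).card ≤ (Finset.Icc 1 N).card := by
    refine Finset.card_le_card_of_injOn (height r S b) ?_ ?_
    · intro s hs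
      have hs' := mem_marked.1 (Finset.mem_filter.1 hs).1
      exact Finset.mem_coe.2 (Finset.mem_Icc.2 ⟨hs'.2.1, hN s hs'.1⟩)
    · intro s hs t ht hst
      have hs' := Finset.mem_filter.1 hs
      have ht' := Finset.mem_filter.1 ht
      rcases hr.comparable _ _ _ hs'.2 ht'.2 with h | h | h
      · exact h
      · have := (mem_marked.1 ht'.1).2.2 s h
        omega
      · have := (mem_marked.1 hs'.1).2.2 t h
        omega
  simpa using h

end IsForest

/-! ### Shortcut sets of inverse Ackermann size. -/

namespace IsForest

/-- Every forest on `S` whose elements have at most `m - 1` elements below them has a set of at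
most `C * |S| * g m` shortcuts, by which comparable elements are joined by at most `t` steps. -/
def ShortcutBound (t : ℕ) (g : ℝ → ℝ) : Prop :=
  ∃ C : ℝ, 0 ≤ C ∧ ∀ (V : Type) [DecidableEq V] (r : V → V → Prop) [DecidableRel r]
    (S : Finset V) (m : ℝ), IsForest r → (∀ x y, r x y → x ∈ S ∧ y ∈ S) → 1 ≤ m →
    (∀ y, ((S.filter fun x => r x y).card : ℝ) + 1 ≤ m) →
    ∃ E : Finset (V × V), (∀ p ∈ E, r p.1 p.2) ∧ (E.card : ℝ) ≤ C * (S.card * g m) ∧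
      ∀ x y, r x y → HopReach (fun a b => (a, b) ∈ E) t x y

theorem not_rel_of_card_lt_two {V : Type*} {r : V → V → Prop} [DecidableRel r] {S : Finset V}
    (hS : ∀ x y, r x y → x ∈ S ∧ y ∈ S) {m : ℝ} (hm : m < 2)
    (h : ∀ y, ((S.filter fun x => r x y).card : ℝ) + 1 ≤ m) (x y : V) : ¬ r x y := by
  intro hxy
  have h1 : 1 ≤ (S.filter fun x => r x y).card :=
    Finset.card_pos.2 ⟨x, Finset.mem_filter.2 ⟨(hS _ _ hxy).1, hxy⟩⟩
  have h2 : (1 : ℝ) ≤ (S.filter fun x => r x y).card := by exact_mod_cast h1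
  linarith [h y]

/-- Halving: with `b = m / 2` all heights are at most 2, so each element has at most two marked
elements strictly above it. Linking it to those, and to the largest marked element below it, costs 3
per element and serves every pair separated by a marked element in two steps. The other pairs
survive in the cut forest, with `m / 2` for `m`. -/
theorem shortcuts_of_le_two_pow (V : Type) [DecidableEq V] (S : Finset V) (i : ℕ) :
    ∀ (r : V → V → Prop) [DecidableRel r] (m : ℝ),
      IsForest r → (∀ x y, r x y → x ∈ S ∧ y ∈ S) → m ≤ 2 ^ i →
      (∀ y, ((S.filter fun x => r x y).card : ℝ) + 1 ≤ m) →
      ∃ E : Finset (V × V), (∀ p ∈ E, r p.1 p.2) ∧ E.card ≤ 3 * S.card * i ∧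
        ∀ x y, r x y → HopReach (fun a b => (a, b) ∈ E) 2 x y := by
  classical
  induction i with
  | zero =>
    intro r _ m hr hS hm hcard
    have hno := not_rel_of_card_lt_two hS (by norm_num at hm; linarith) hcard
    exact ⟨∅, by simp, by simp, fun x y h => absurd h (hno x y)⟩
  | succ i ih =>
    intro r _ m hr hS hm hcard
    by_cases hm2 : m < 2
    · have hno := not_rel_of_card_lt_two hS hm2 hcard
      exact ⟨∅, by simp, by simp, fun x y h => absurd h (hno x y)⟩
    push Not at hm2
    have hb : 0 < m / 2 := by linarith
    set M := marked r S (m / 2) with hM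
    choose fl hfl using hr.exists_floor hS hb
    have hS' : ∀ x y, cut r M x y → x ∈ S ∧ y ∈ S := fun x y h => hS x y h.1
    obtain ⟨E', hE'r, hE'card, hE'⟩ := ih (cut r M) (m / 2) (hr.isForest_cut M) hS'
      (by rw [pow_succ] at hm; linarith) (fun y => by
        have h := hr.card_cut_marked_lt hS hb y
        rw [max_eq_right (by linarith)] at h
        convert h using 4)
    have hheight : ∀ y ∈ S, height r S (m / 2) y ≤ 2 := by
      intro y hy
      have h1 := mul_height_le (r := r) (S := S) hb y
      have h2 : down r S y = insert y (S.filter fun x => r x y) := by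
        ext x
        simp only [mem_down, Finset.mem_insert, Finset.mem_filter]
        constructor
        · rintro ⟨h1, h2 | h2⟩
          · exact .inl h2
          · exact .inr ⟨h1, h2⟩
        · rintro (rfl | h)
          · exact ⟨hy, .inl rfl⟩
          · exact ⟨h.1, .inr h.2⟩
      have h3 : ((down r S y).card : ℝ) ≤ m := by
        rw [h2]
        refine le_trans ?_ (hcard y)
        exact_mod_cast Finset.card_insert_le _ _
      have h4 : (height r S (m / 2) y : ℝ) ≤ 2 := by
        by_contra! hcon
        nlinarith
      exact_mod_cast h4
    set A := S.biUnion fun x => (M.filter fun s => r x s).image fun s => (x, s) with hA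
    set B := (S.filter fun y => r (fl y) y).image fun y => (fl y, y) with hB
    refine ⟨E' ∪ (A ∪ B), ?_, ?_, ?_⟩
    · intro p hp
      simp only [hA, hB, Finset.mem_union, Finset.mem_biUnion, Finset.mem_image,
        Finset.mem_filter] at hp
      rcases hp with hp | ⟨x, _, s, ⟨_, h⟩, rfl⟩ | ⟨y, ⟨_, h⟩, rfl⟩
      · exact (hE'r p hp).1
      · exact h
      · exact h
    · have h1 : A.card ≤ S.card * 2 := by
        refine Finset.card_biUnion_le_card_mul _ _ _ fun x _ => Finset.card_image_le.trans ?_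
        exact (le_of_eq (by congr)).trans (hr.card_marked_above_le hheight x)
      have h2 : B.card ≤ S.card :=
        Finset.card_image_le.trans (Finset.card_le_card (Finset.filter_subset _ _))
      have h3 := Finset.card_union_le E' (A ∪ B)
      have h4 := Finset.card_union_le A B
      calc _ ≤ 3 * S.card * i + (S.card * 2 + S.card) := by omega
        _ = _ := by ring
    · intro x y hxy
      by_cases hcut : cut r M x y
      · exact (hE' x y hcut).mono (fun a b h => Finset.mem_union_left _ h) le_rfl
      · have : ∃ s ∈ M, (x = s ∨ r x s) ∧ (s = y ∨ r s y) := by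
          by_contra! hcon
          exact hcut ⟨hxy, fun s hs h => by
            rcases h.2 with h' | h'
            · exact (hcon s hs h.1).1 h'
            · exact (hcon s hs h.1).2 h'⟩
        obtain ⟨s, hs, hxs, hsy⟩ := this
        obtain ⟨h1, h2, h3⟩ := hfl y s hs hsy
        refine HopReach.trans (m := 1) (n := 1) (y := fl y) (.single ?_) (.single ?_)
        · have hx : x = fl y ∨ r x (fl y) := by
            rcases hxs with rfl | hxs
            · exact h2
            · rcases h2 with h2 | h2
              · exact .inr (h2 ▸ hxs)
              · exact .inr (hr.trans _ _ _ hxs h2)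
          refine hx.imp_right fun h => ?_
          refine Finset.mem_union_right _ (Finset.mem_union_left _ ?_)
          exact Finset.mem_biUnion.2 ⟨x, (hS _ _ hxy).1,
            Finset.mem_image.2 ⟨fl y, Finset.mem_filter.2 ⟨h1, h⟩, rfl⟩⟩
        · refine h3.imp_right fun h => ?_
          refine Finset.mem_union_right _ (Finset.mem_union_right _ ?_)
          exact Finset.mem_image.2 ⟨y, Finset.mem_filter.2 ⟨(hS _ _ hxy).2, h⟩, rfl⟩

theorem shortcutBound_logb : ShortcutBound 2 (invAck 1) := by
  refine ⟨6, by norm_num, fun V _ r _ S m hr hS hm hcard => ?_⟩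
  change ∃ E : Finset (V × V), _ ∧ _ ≤ 6 * (_ * Real.logb 2 m) ∧ _
  by_cases hm2 : m < 2
  · have hno := not_rel_of_card_lt_two hS hm2 hcard
    refine ⟨∅, by simp, ?_, fun x y h => absurd h (hno x y)⟩
    have := Real.logb_nonneg (b := 2) (by norm_num) hm
    simp only [Finset.card_empty, Nat.cast_zero]
    positivity
  push Not at hm2
  have hlog : 1 ≤ Real.logb 2 m := by
    rw [Real.le_logb_iff_rpow_le (by norm_num) (by linarith)]
    simpa using hm2
  have hmle : m ≤ 2 ^ ⌈Real.logb 2 m⌉₊ := by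
    rw [← Real.rpow_natCast, ← Real.logb_le_iff_le_rpow (by norm_num) (by linarith)]
    exact Nat.le_ceil _
  obtain ⟨E, h1, h2, h3⟩ := shortcuts_of_le_two_pow V S _ r m hr hS hmle hcard
  refine ⟨E, h1, ?_, h3⟩
  -- Since `m ≥ 2`, rounding up at most doubles the logarithm; hence the constant `6 = 3 * 2`.
  have h4 : (⌈Real.logb 2 m⌉₊ : ℝ) ≤ 2 * Real.logb 2 m := by
    have := Nat.ceil_lt_add_one (a := Real.logb 2 m) (by linarith)
    linarith
  calc (E.card : ℝ) ≤ 3 * S.card * (⌈Real.logb 2 m⌉₊ : ℝ) := by exact_mod_cast h2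
    _ ≤ 3 * S.card * (2 * Real.logb 2 m) := by gcongr
    _ = _ := by ring

/-- One level of the hierarchy, by induction on the number of rounds. A pair separated by a marked
element goes up to the first marked element above `x`, along shortcuts of the previous level to the
last one below `y`, then to `y`: `t + 2` steps. The bound `max 1 m` accommodates values of `f` below
1. -/
theorem shortcuts_of_iterate_le_one {t : ℕ} {f : ℝ → ℝ} (hf : ∀ x, 1 < x → 0 < f x) {C : ℝ}
    (hC : 0 ≤ C) (V : Type) [DecidableEq V] (S : Finset V)
    (hrec : ∀ (r : V → V → Prop) [DecidableRel r] (S : Finset V) (m : ℝ), IsForest r →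
      (∀ x y, r x y → x ∈ S ∧ y ∈ S) → 1 ≤ m →
      (∀ y, ((S.filter fun x => r x y).card : ℝ) + 1 ≤ m) →
      ∃ E : Finset (V × V), (∀ p ∈ E, r p.1 p.2) ∧ (E.card : ℝ) ≤ C * (S.card * f m) ∧
        ∀ x y, r x y → HopReach (fun a b => (a, b) ∈ E) t x y) (i : ℕ) :
    ∀ (r : V → V → Prop) [DecidableRel r] (m : ℝ),
      IsForest r → (∀ x y, r x y → x ∈ S ∧ y ∈ S) → f^[i] m ≤ 1 →
      (∀ y, ((S.filter fun x => r x y).card : ℝ) + 1 ≤ max 1 m) →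
      ∃ E : Finset (V × V), (∀ p ∈ E, r p.1 p.2) ∧ (E.card : ℝ) ≤ (2 + 2 * C) * (S.card * i) ∧
        ∀ x y, r x y → HopReach (fun a b => (a, b) ∈ E) (t + 2) x y := by
  classical
  have htriv : ∀ (r : V → V → Prop) [DecidableRel r] (m : ℝ) (i : ℕ),
      (∀ x y, r x y → x ∈ S ∧ y ∈ S) → m ≤ 1 →
      (∀ y, ((S.filter fun x => r x y).card : ℝ) + 1 ≤ max 1 m) →
      ∃ E : Finset (V × V), (∀ p ∈ E, r p.1 p.2) ∧ (E.card : ℝ) ≤ (2 + 2 * C) * (S.card * i) ∧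
        ∀ x y, r x y → HopReach (fun a b => (a, b) ∈ E) (t + 2) x y := by
    intro r _ m i hS hm hcard
    have hno := not_rel_of_card_lt_two (m := max 1 m) hS
      (by rw [max_eq_left hm]; norm_num) hcard
    refine ⟨∅, by simp, ?_, fun x y h => absurd h (hno x y)⟩
    simp only [Finset.card_empty, Nat.cast_zero]
    positivity
  induction i with
  | zero =>
    intro r _ m hr hS hm hcard
    exact htriv r m 0 hS (by simpa using hm) hcard
  | succ i ih =>
    intro r _ m hr hS hm hcard
    by_cases hm1 : m ≤ 1
    · exact htriv r m (i + 1) hS hm1 hcard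
    push Not at hm1
    rw [max_eq_right hm1.le] at hcard
    have hb : 0 < f m := hf m hm1
    set M := marked r S (f m) with hM
    choose fl hfl using hr.exists_floor hS hb
    choose ce hce using hr.exists_ceil M
    obtain ⟨E', hE'r, hE'card, hE'⟩ := ih (cut r M) (f m) (hr.isForest_cut M)
      (fun x y h => hS x y h.1) hm (fun y => by
        convert hr.card_cut_marked_lt hS hb y using 4)
    obtain ⟨F, hFr, hFcard, hF⟩ := hrec (fun x y => r x y ∧ x ∈ M ∧ y ∈ M) M m
      (hr.isForest_restrict M) (fun x y h => h.2) hm1.le (fun y => by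
        refine le_trans ?_ (hcard y)
        gcongr ?_ + 1
        refine Nat.cast_le.2 (Finset.card_le_card fun x hx => ?_)
        rw [Finset.mem_filter] at hx ⊢
        exact ⟨marked_subset _ _ _ hx.1, hx.2.1⟩)
    set A := (S.filter fun x => r x (ce x)).image fun x => (x, ce x) with hA
    set B := (S.filter fun y => r (fl y) y).image fun y => (fl y, y) with hB
    refine ⟨(E' ∪ F) ∪ (A ∪ B), ?_, ?_, ?_⟩
    · intro p hp
      simp only [hA, hB, Finset.mem_union, Finset.mem_image, Finset.mem_filter] at hp
      rcases hp with (hp | hp) | ⟨y, ⟨_, h⟩, rfl⟩ | ⟨y, ⟨_, h⟩, rfl⟩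
      · exact (hE'r p hp).1
      · exact (hFr p hp).1
      · exact h
      · exact h
    · have h1 : A.card ≤ S.card :=
        Finset.card_image_le.trans (Finset.card_le_card (Finset.filter_subset _ _))
      have h2 : B.card ≤ S.card :=
        Finset.card_image_le.trans (Finset.card_le_card (Finset.filter_subset _ _))
      have h3 := Finset.card_union_le (E' ∪ F) (A ∪ B)
      have h4 := Finset.card_union_le A B
      have h5 := Finset.card_union_le E' F
      have h6 : ((E' ∪ F ∪ (A ∪ B)).card : ℝ) ≤ E'.card + F.card + (S.card + S.card) := by
        exact_mod_cast (by omega : (E' ∪ F ∪ (A ∪ B)).card ≤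
          E'.card + F.card + (S.card + S.card))
      -- The choice `b = f m` makes the number of marked elements cancel the factor `f m` in the
      -- cost of the previous level.
      have h7 : C * (M.card * f m) ≤ C * (2 * S.card) :=
        mul_le_mul_of_nonneg_left (hr.card_marked_mul_le hb) hC
      push_cast
      linarith
    · intro x y hxy
      by_cases hcut : cut r M x y
      · exact (hE' x y hcut).mono
          (fun a b h => Finset.mem_union_left _ (Finset.mem_union_left _ h)) le_rfl
      · have : ∃ s ∈ M, (x = s ∨ r x s) ∧ (s = y ∨ r s y) := by
          by_contra! hcon
          exact hcut ⟨hxy, fun s hs h => by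
            rcases h.2 with h' | h'
            · exact (hcon s hs h.1).1 h'
            · exact (hcon s hs h.1).2 h'⟩
        obtain ⟨s, hs, hxs, hsy⟩ := this
        obtain ⟨h1, h2, h3⟩ := hfl y s hs hsy
        obtain ⟨h4, h5, h6⟩ := hce x s hs hxs
        have hxS := (hS _ _ hxy).1
        have hyS := (hS _ _ hxy).2
        have step1 : HopReach (fun a b => (a, b) ∈ (E' ∪ F) ∪ (A ∪ B)) 1 x (ce x) := by
          refine .single (h5.imp_right fun h => ?_)
          refine Finset.mem_union_right _ (Finset.mem_union_left _ ?_)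
          exact Finset.mem_image.2 ⟨x, Finset.mem_filter.2 ⟨hxS, h⟩, rfl⟩
        have step3 : HopReach (fun a b => (a, b) ∈ (E' ∪ F) ∪ (A ∪ B)) 1 (fl y) y := by
          refine .single (h3.imp_right fun h => ?_)
          refine Finset.mem_union_right _ (Finset.mem_union_right _ ?_)
          exact Finset.mem_image.2 ⟨y, Finset.mem_filter.2 ⟨hyS, h⟩, rfl⟩
        have hle : ce x = fl y ∨ r (ce x) (fl y) := by
          rcases h6 with h6 | h6
          · exact h6 ▸ h2
          · rcases h2 with h2 | h2
            · exact .inr (h2 ▸ h6)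
            · exact .inr (hr.trans _ _ _ h6 h2)
        have step2 : HopReach (fun a b => (a, b) ∈ (E' ∪ F) ∪ (A ∪ B)) t (ce x) (fl y) := by
          rcases hle with h | h
          · rw [h]
            exact .refl _ _
          · exact (hF _ _ ⟨h, h4, h1⟩).mono
              (fun a b h => Finset.mem_union_left _ (Finset.mem_union_right _ h)) le_rfl
        exact ((step1.trans step2).trans step3).mono (fun _ _ h => h) (by omega)

theorem invAck_pos (k : ℕ) {x : ℝ} (hx : 1 < x) : 0 < invAck (k + 1) x := by
  cases k with
  | zero => exact Real.logb_pos (by norm_num) hx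
  | succ k =>
    change (0 : ℝ) < ((sInf {i : ℕ | (invAck (k + 1))^[i] x ≤ 1} : ℕ) : ℝ)
    have h := Nat.sInf_mem (invAck_iterate_nonempty k x)
    rw [Nat.cast_pos, Nat.pos_iff_ne_zero]
    intro h0
    rw [h0] at h
    exact absurd h (by simpa using hx)

theorem shortcutBound_invAck (k : ℕ) : ShortcutBound (2 * (k + 1)) (invAck (k + 1)) := by
  induction k with
  | zero => exact shortcutBound_logb
  | succ k ih =>
    obtain ⟨C, hC, h⟩ := ih
    refine ⟨2 + 2 * C, by positivity, fun V _ r _ S m hr hS hm hcard => ?_⟩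
    exact shortcuts_of_iterate_le_one (fun x hx => invAck_pos k hx) hC V S
      (fun r _ S m => h V r S m) _ r m hr hS (Nat.sInf_mem (invAck_iterate_nonempty k m))
      (fun y => (hcard y).trans (le_max_right _ _))

end IsForest

/-! ### Realizing shortcuts by edges through cliques. -/

/-- The edges of `G` that join the two entries of a pair in `Q`. -/
def pairGraph {V : Type*} (G : SimpleGraph V) (Q : Finset (V × V)) : SimpleGraph V where
  Adj a b := G.Adj a b ∧ ((a, b) ∈ Q ∨ (b, a) ∈ Q)
  symm := ⟨fun _ _ h => ⟨h.1.symm, h.2.symm⟩⟩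
  loopless := ⟨fun _ h => G.loopless.irrefl _ h.1⟩

theorem ncard_edgeSet_pairGraph_le {V : Type*} (G : SimpleGraph V) (Q : Finset (V × V)) :
    (pairGraph G Q).edgeSet.ncard ≤ Q.card := by
  classical
  have hsub : (pairGraph G Q).edgeSet ⊆ (Q.image fun p => s(p.1, p.2) : Finset (Sym2 V)) := by
    intro e he
    induction e with
    | _ a b =>
      rw [SimpleGraph.mem_edgeSet] at he
      rw [Finset.mem_coe, Finset.mem_image]
      rcases he.2 with h | h
      · exact ⟨(a, b), h, rfl⟩
      · exact ⟨(b, a), h, Sym2.eq_swap⟩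
  refine (Set.ncard_le_ncard hsub (Finset.finite_toSet _)).trans ?_
  rw [Set.ncard_coe_finset]
  exact Finset.card_image_le

theorem HopReach.exists_walk {V : Type*} {H : SimpleGraph V} {n : ℕ} {u v : V}
    (h : HopReach H.Adj n u v) : ∃ p : H.Walk u v, p.length ≤ n := by
  induction h with
  | refl n x => exact ⟨.nil, by simp⟩
  | head h1 _ ih =>
    obtain ⟨p, hp⟩ := ih
    exact ⟨.cons h1 p, by simpa using hp⟩

section

variable {V : Type*} {G : SimpleGraph V} {c : ℕ} {K : V → Fin c → Set V}

open Classical in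
/-- A member of the set `A` if it is nonempty, and `x` otherwise. -/
noncomputable def memberOr {V : Type*} (A : Set V) (x : V) : V :=
  if h : A.Nonempty then h.some else x

theorem memberOr_mem {A : Set V} (h : A.Nonempty) (x : V) : memberOr A x ∈ A := by
  rw [memberOr, dif_pos h]
  exact h.some_mem

open Classical in
/-- The pairs of vertices that realize the shortcut from `x` to `y` in a spanner. -/
noncomputable def spannerPairs (G : SimpleGraph V) (K : V → Fin c → Set V) (x y : V) :
    Finset (V × V) :=
  let rep := fun z i => memberOr (K z i) z
  let joint := fun i j => memberOr (K x i ∩ K y j) x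
  let near := fun j => memberOr {w | w ∈ K y j ∧ (x = w ∨ G.Adj x w)} x
  {(x, y)} ∪ (Finset.univ.image fun i => (rep x i, y)) ∪
    ((Finset.univ.image fun j => (x, near j)) ∪ (Finset.univ.image fun j => (near j, rep y j))) ∪
    ((Finset.univ.image fun p : Fin c × Fin c => (rep x p.1, joint p.1 p.2)) ∪
      (Finset.univ.image fun p : Fin c × Fin c => (joint p.1 p.2, rep y p.2)))

theorem card_spannerPairs_le (G : SimpleGraph V) (K : V → Fin c → Set V) (x y : V) :
    (spannerPairs G K x y).card ≤ 1 + 3 * c + 2 * c ^ 2 := by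
  classical
  have h1 : ∀ f : Fin c → V × V, (Finset.univ.image f).card ≤ c := fun f =>
    Finset.card_image_le.trans (by simp)
  have h2 : ∀ f : Fin c × Fin c → V × V, (Finset.univ.image f).card ≤ c ^ 2 := fun f =>
    Finset.card_image_le.trans (by simp [sq])
  unfold spannerPairs
  refine (Finset.card_union_le _ _).trans ?_
  have e1 : ∀ A B C D : Finset (V × V), (A ∪ B ∪ (C ∪ D)).card ≤
      A.card + B.card + (C.card + D.card) := fun A B C D =>
    (Finset.card_union_le _ _).trans (add_le_add (Finset.card_union_le _ _)
      (Finset.card_union_le _ _))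
  calc _ ≤ (1 + c + (c + c)) + (c ^ 2 + c ^ 2) := by
        refine add_le_add ((e1 _ _ _ _).trans ?_) ((Finset.card_union_le _ _).trans ?_)
        · exact add_le_add (add_le_add (by simp) (h1 _)) (add_le_add (h1 _) (h1 _))
        · exact add_le_add (h2 _) (h2 _)
    _ = _ := by ring

variable {r : V → V → Prop} {E : Finset (V × V)} {Q : Finset (V × V)}

theorem hopReach_pairGraph_of_mem {a b : V} (hab : a = b ∨ G.Adj a b) (hQ : (a, b) ∈ Q) :
    HopReach (pairGraph G Q).Adj 1 a b :=
  .single (hab.imp_right fun h => ⟨h, .inl hQ⟩)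

/-- A shortcut path that starts in a clique containing `v` and ends in `v` is realized in the
graph of the pairs belonging to the shortcuts. -/
theorem hopReach_rep (hr : IsForest r) (hE : ∀ p ∈ E, r p.1 p.2)
    (hK : ∀ z i, ∀ a ∈ K z i, ∀ b ∈ K z i, a = b ∨ G.Adj a b) {u v : V}
    (hcover : ∀ z, r u z → r z v → ∃ i, v ∈ K z i)
    (hQ : ∀ p ∈ E, spannerPairs G K p.1 p.2 ⊆ Q) {j : ℕ} {z v' : V}
    (h : HopReach (fun a b => (a, b) ∈ E) j z v') (hv' : v' = v) (huz : r u z) (hzv : r z v)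
    {i : Fin c} (hi : v ∈ K z i) :
    HopReach (pairGraph G Q).Adj (2 * j - 1) (memberOr (K z i) z) v := by
  classical
  induction h generalizing i with
  | refl n x =>
    subst hv'
    exact absurd hzv (hr.irrefl _)
  | @head n x y w hxy hyw ih =>
    subst hv'
    have hx : memberOr (K x i) x ∈ K x i := memberOr_mem (A := K x i) ⟨_, hi⟩ x
    have hsub := hQ _ hxy
    rcases hyw.eq_or_of_trans (fun a b h => hE _ h) hr.trans with rfl | hyv
    · refine (hopReach_pairGraph_of_mem (hK x i _ hx _ hi) (hsub ?_)).mono (fun _ _ h => h)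
        (by omega)
      simp [spannerPairs]
    -- Since `v` lies in a clique at `x` and in one at `y`, the two cliques share a vertex, which
    -- connects their representatives in two hops.
    · have huy : r u y := hr.trans _ _ _ huz (hE _ hxy)
      obtain ⟨i', hi'⟩ := hcover y huy hyv
      have hy : memberOr (K y i') y ∈ K y i' := memberOr_mem (A := K y i') ⟨_, hi'⟩ y
      have hw : memberOr (K x i ∩ K y i') x ∈ K x i ∩ K y i' := memberOr_mem (A := K x i ∩ K y i') ⟨_, hi, hi'⟩ x
      -- Needed because `2 * n - 1` is truncated at `n = 0`.
      have hn : n ≠ 0 := by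
        rintro rfl
        cases hyw
        exact hr.irrefl _ hyv
      have s1 : HopReach (pairGraph G Q).Adj 1 (memberOr (K x i) x)
          (memberOr (K x i ∩ K y i') x) := by
        refine hopReach_pairGraph_of_mem (hK x i _ hx _ hw.1) (hsub ?_)
        simp only [spannerPairs, Finset.mem_union, Finset.mem_image]
        exact .inr (.inl ⟨(i, i'), Finset.mem_univ _, rfl⟩)
      have s2 : HopReach (pairGraph G Q).Adj 1 (memberOr (K x i ∩ K y i') x)
          (memberOr (K y i') y) := by
        refine hopReach_pairGraph_of_mem (hK y i' _ hw.2 _ hy) (hsub ?_)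
        simp only [spannerPairs, Finset.mem_union, Finset.mem_image]
        exact .inr (.inr ⟨(i, i'), Finset.mem_univ _, rfl⟩)
      exact ((s1.trans s2).trans (ih rfl huy hyv hi')).mono (fun _ _ h => h) (by omega)

/-- The start `u` need not belong to the clique at `y` that contains `v`, but it is adjacent to the
member `v`. So the stored neighbour of `u` in that clique exists, and leads to its representative in
two hops; `hopReach_rep` does the rest. -/
theorem hopReach_of_shortcuts (hr : IsForest r) (hE : ∀ p ∈ E, r p.1 p.2)
    (hK : ∀ z i, ∀ a ∈ K z i, ∀ b ∈ K z i, a = b ∨ G.Adj a b) {u v : V}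
    (hcover : ∀ z, r u z → r z v → ∃ i, v ∈ K z i)
    (hQ : ∀ p ∈ E, spannerPairs G K p.1 p.2 ⊆ Q) {j : ℕ}
    (h : HopReach (fun a b => (a, b) ∈ E) j u v) (huv : r u v) (hadj : G.Adj u v) :
    HopReach (pairGraph G Q).Adj (2 * j - 1) u v := by
  classical
  cases h with
  | refl n x => exact .refl _ _
  | @head n _ y _ huy hyv =>
    have hsub := hQ _ huy
    rcases hyv.eq_or_of_trans (fun a b h => hE _ h) hr.trans with rfl | hyv'
    · refine (hopReach_pairGraph_of_mem (.inr hadj) (hsub ?_)).mono (fun _ _ h => h) (by omega)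
      simp [spannerPairs]
    · have hn : n ≠ 0 := by
        rintro rfl
        cases hyv
        exact hr.irrefl _ hyv'
      obtain ⟨i, hi⟩ := hcover y (hE _ huy) hyv'
      have hy : memberOr (K y i) y ∈ K y i := memberOr_mem (A := K y i) ⟨_, hi⟩ y
      have hw : memberOr {w | w ∈ K y i ∧ (u = w ∨ G.Adj u w)} u ∈
          {w | w ∈ K y i ∧ (u = w ∨ G.Adj u w)} := memberOr_mem
          (A := {w | w ∈ K y i ∧ (u = w ∨ G.Adj u w)}) ⟨v, hi, .inr hadj⟩ u
      have s1 : HopReach (pairGraph G Q).Adj 1 u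
          (memberOr {w | w ∈ K y i ∧ (u = w ∨ G.Adj u w)} u) := by
        refine hopReach_pairGraph_of_mem hw.2 (hsub ?_)
        simp only [spannerPairs, Finset.mem_union, Finset.mem_image]
        exact .inl (.inr (.inl ⟨i, Finset.mem_univ _, rfl⟩))
      have s2 : HopReach (pairGraph G Q).Adj 1
          (memberOr {w | w ∈ K y i ∧ (u = w ∨ G.Adj u w)} u) (memberOr (K y i) y) := by
        refine hopReach_pairGraph_of_mem (hK y i _ hw.1 _ hy) (hsub ?_)
        simp only [spannerPairs, Finset.mem_union, Finset.mem_image]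
        exact .inl (.inr (.inr ⟨i, Finset.mem_univ _, rfl⟩))
      exact ((s1.trans s2).trans (hopReach_rep hr hE hK hcover hQ hyv rfl (hE _ huy) hyv'
        hi)).mono (fun _ _ h => h) (by omega)

end

/-! ### Side lengths, hitting sets and shifted grids. -/

section Geometry

variable {d : ℕ} {u v : Set (Fin d → ℝ)} {a : Fin d → ℝ} {l : ℝ}

theorem hypercube_mono (a : Fin d → ℝ) {l l' : ℝ} (h : l ≤ l') :
    hypercube a l ⊆ hypercube a l' :=
  fun _ hx i => ⟨(hx i).1, (hx i).2.trans (by linarith)⟩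

theorem isBounded_hypercube (a : Fin d → ℝ) (l : ℝ) : Bornology.IsBounded (hypercube a l) := by
  refine (Metric.isBounded_Icc a (fun i => a i + l)).subset fun x hx => ?_
  exact ⟨fun i => (hx i).1, fun i => (hx i).2⟩

theorem exists_subset_hypercube (hu : Bornology.IsBounded u) :
    ∃ l, 0 ≤ l ∧ ∃ a : Fin d → ℝ, u ⊆ hypercube a l := by
  obtain ⟨R, hR⟩ := isBounded_iff_forall_norm_le.1 hu
  refine ⟨2 * max R 0, by positivity, fun _ => -max R 0, fun x hx i => ?_⟩
  have h := (norm_le_pi_norm x i).trans ((hR x hx).trans (le_max_left R 0))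
  rw [Real.norm_eq_abs, abs_le] at h
  constructor <;> linarith

theorem sideLength_le (hl : 0 ≤ l) (h : u ⊆ hypercube a l) : sideLength u ≤ l :=
  csInf_le ⟨0, fun _ h => h.1⟩ ⟨hl, a, h⟩

theorem sideLength_nonneg (u : Set (Fin d → ℝ)) : 0 ≤ sideLength u :=
  Real.sInf_nonneg fun _ h => h.1

theorem exists_subset_hypercube_of_sideLength_lt (hu : Bornology.IsBounded u)
    (h : sideLength u < l) : ∃ a : Fin d → ℝ, u ⊆ hypercube a l := by
  obtain ⟨l', ⟨_, a, ha⟩, hl'⟩ := exists_lt_of_csInf_lt (exists_subset_hypercube hu) h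
  exact ⟨a, ha.trans (hypercube_mono a hl'.le)⟩

theorem sideLength_mono (hv : Bornology.IsBounded v) (h : u ⊆ v) :
    sideLength u ≤ sideLength v := by
  refine le_of_forall_gt_imp_ge_of_dense fun l hl => ?_
  obtain ⟨a, ha⟩ := exists_subset_hypercube_of_sideLength_lt hv hl
  exact sideLength_le ((sideLength_nonneg v).trans hl.le) (h.trans ha)

theorem subsingleton_of_sideLength_eq_zero (hu : Bornology.IsBounded u)
    (h : sideLength u = 0) : u.Subsingleton := by
  intro x hx y hy
  ext i
  have key : ∀ x ∈ u, ∀ y ∈ u, x i ≤ y i := by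
    intro x hx y hy
    refine le_of_forall_pos_le_add fun ε hε => ?_
    obtain ⟨a, ha⟩ := exists_subset_hypercube_of_sideLength_lt hu (h ▸ hε)
    linarith [(ha hx i).2, (ha hy i).1]
  exact le_antisymm (key x hx y hy) (key y hy x hx)

/-- In a fat family, the objects that meet a bounded set and are not much smaller than it are hit
by a bounded number of points. -/
theorem IsFat.exists_hitting_set {ι : Type*} {c : ℕ} {obj : ι → Set (Fin d → ℝ)}
    (hfat : IsFat c obj) {N : ℕ} (hN : 0 < N)
    {W : Set (Fin d → ℝ)} (hW : Bornology.IsBounded W) :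
    ∃ P : Finset (Fin d → ℝ), P.card ≤ c * (2 * N + 1) ^ d + 1 ∧
      ∀ i, (obj i ∩ W).Nonempty → sideLength W ≤ N * sideLength (obj i) →
        ∃ p ∈ P, p ∈ obj i := by
  classical
  -- Fatness says nothing about cubes of side zero, but a one-point `W` is its own hitting set; this
  -- is the `+ 1` in the bound.
  rcases (sideLength_nonneg W).eq_or_lt with h0 | hpos
  · have hsub := subsingleton_of_sideLength_eq_zero hW h0.symm
    rcases W.eq_empty_or_nonempty with rfl | ⟨p, hp⟩
    · exact ⟨∅, by simp, fun i hi => absurd hi (by simp)⟩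
    refine ⟨{p}, by simp, fun i hi _ => ?_⟩
    obtain ⟨x, hx, hxW⟩ := hi
    obtain rfl := hsub hp hxW
    exact ⟨p, Finset.mem_singleton_self _, hx⟩
  · set g := sideLength W with hg
    have hN' : (0 : ℝ) < N := by exact_mod_cast hN
    have hl0 : 0 < g / N := by positivity
    -- A cube of side `2 * g` avoids having to show that the infimum is attained. It is covered by
    -- small cubes of side `g / N`, with indices `0, …, 2 * N` in each coordinate since the upper
    -- boundary is included.
    obtain ⟨a, ha⟩ := exists_subset_hypercube_of_sideLength_lt hW (l := 2 * g) (by linarith)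
    choose P hP hhit using fun e : Fin d → Fin (2 * N + 1) =>
      hfat (fun i => a i + (e i : ℕ) * (g / N)) (g / N) hl0
    refine ⟨Finset.univ.biUnion P, ?_, fun i hi hs => ?_⟩
    · refine (Finset.card_biUnion_le_card_mul _ _ c fun e _ => hP e).trans ?_
      simp only [Finset.card_univ, Fintype.card_fun, Fintype.card_fin]
      rw [mul_comm]
      exact Nat.le_succ _
    · obtain ⟨x, hx, hxW⟩ := hi
      have hxa := ha hxW
      have hfl : ∀ i, ⌊(x i - a i) / (g / N)⌋₊ < 2 * N + 1 := by
        intro i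
        refine Nat.lt_succ_of_le (Nat.floor_le_of_le ?_)
        rw [div_le_iff₀ hl0]
        push_cast
        have : 2 * (N : ℝ) * (g / N) = 2 * g := by field_simp
        linarith [(hxa i).2]
      have hmem : x ∈ hypercube (fun i => a i + (⌊(x i - a i) / (g / N)⌋₊ : ℝ) * (g / N))
          (g / N) := by
        intro i
        have h1 := Nat.floor_le (div_nonneg (sub_nonneg.2 (hxa i).1) hl0.le)
        have h2 := Nat.lt_floor_add_one ((x i - a i) / (g / N))
        rw [le_div_iff₀ hl0] at h1
        rw [div_lt_iff₀ hl0] at h2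
        constructor <;> linarith
      obtain ⟨p, hp, hpi⟩ := hhit (fun i => ⟨_, hfl i⟩) i ⟨x, hx, hmem⟩ (by
        rw [div_le_iff₀ hN']
        linarith)
      exact ⟨p, Finset.mem_biUnion.2 ⟨_, Finset.mem_univ _, hp⟩, hpi⟩

/-- The cell that contains `x` in the grid of side length `2 ^ s` shifted by `t`. -/
def gridCell (t : ℝ) (s : ℤ) (x : Fin d → ℝ) : Set (Fin d → ℝ) :=
  {y | ∀ i, ⌊(y i - t) / 2 ^ s⌋ = ⌊(x i - t) / 2 ^ s⌋}

theorem gridCell_subset_hypercube (t : ℝ) (s : ℤ) (x : Fin d → ℝ) :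
    gridCell t s x ⊆ hypercube (fun i => t + ⌊(x i - t) / 2 ^ s⌋ * 2 ^ s) (2 ^ s) := by
  intro y hy i
  have hpos : (0 : ℝ) < 2 ^ s := by positivity
  have h1 := Int.floor_le ((y i - t) / 2 ^ s)
  have h2 := Int.lt_floor_add_one ((y i - t) / 2 ^ s)
  rw [hy i, le_div_iff₀ hpos] at h1
  rw [hy i, div_lt_iff₀ hpos] at h2
  constructor <;> linarith

/-- Each dyadic grid refines the coarser ones with the same origin. -/
theorem floor_div_zpow_eq {x y : ℝ} {s s' : ℤ} (hs : s ≤ s')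
    (h : ⌊x / 2 ^ s⌋ = ⌊y / 2 ^ s⌋) : ⌊x / 2 ^ s'⌋ = ⌊y / 2 ^ s'⌋ := by
  obtain ⟨m, rfl⟩ := Int.le.dest hs
  have key : ∀ x : ℝ, ⌊x / 2 ^ (s + m)⌋ = ⌊x / 2 ^ s⌋ / ((2 ^ m : ℕ) : ℤ) := by
    intro x
    rw [← Int.floor_div_natCast]
    congr 1
    rw [zpow_add₀ (by norm_num), zpow_natCast, div_div]
    push_cast
    rfl
  rw [key, key, h]

theorem gridCell_subset {t : ℝ} {s s' : ℤ} (hs : s ≤ s') {x y z : Fin d → ℝ}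
    (hx : z ∈ gridCell t s x) (hy : z ∈ gridCell t s' y) : gridCell t s x ⊆ gridCell t s' y := by
  intro w hw i
  rw [← hy i]
  exact floor_div_zpow_eq hs ((hw i).trans (hx i).symm)

/-- The `j`-th of `M` shifts that are equidistant modulo every power of two up to `2 ^ T`. -/
noncomputable def gridShift (M : ℕ) (T : ℤ) (j : ℕ) : ℝ :=
  j * 2 ^ T / M

/-- A short interval contains a grid point for at most one of the shifts. -/
theorem gridShift_inj {M : ℕ} (hM : Odd M) {s T : ℤ} (hs : s ≤ T) {a l : ℝ} (hl0 : 0 ≤ l)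
    (hl : M * l < 2 ^ s) {j j' : Fin M}
    (h : ⌊(a - gridShift M T j) / 2 ^ s⌋ ≠ ⌊(a + l - gridShift M T j) / 2 ^ s⌋)
    (h' : ⌊(a - gridShift M T j') / 2 ^ s⌋ ≠ ⌊(a + l - gridShift M T j') / 2 ^ s⌋) :
    j = j' := by
  obtain ⟨m, rfl⟩ := Int.le.dest hs
  have hpos : (0 : ℝ) < 2 ^ s := by positivity
  have hM0 : (0 : ℝ) < M := by exact_mod_cast hM.pos
  -- A grid point in `(a, a + l]`, scaled by `M`, is an integer multiple of `2 ^ s`. Two such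
  -- multiples in an interval of length `M * l < 2 ^ s` must coincide.
  have key : ∀ j : Fin M,
      ⌊(a - gridShift M (s + m) j) / 2 ^ s⌋ ≠ ⌊(a + l - gridShift M (s + m) j) / 2 ^ s⌋ →
      ∃ q : ℤ, M * a < (M * q + j * 2 ^ m : ℤ) * 2 ^ s ∧
        (M * q + j * 2 ^ m : ℤ) * (2 : ℝ) ^ s ≤ M * a + M * l := by
    intro j h
    refine ⟨⌊(a + l - gridShift M (s + m) j) / 2 ^ s⌋, ?_⟩
    set q := ⌊(a + l - gridShift M (s + m) j) / 2 ^ s⌋ with hq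
    have hlt : ⌊(a - gridShift M (s + m) j) / 2 ^ s⌋ < q := by
      refine lt_of_le_of_ne (Int.floor_le_floor ?_) h
      gcongr
      linarith
    rw [Int.floor_lt, div_lt_iff₀ hpos] at hlt
    have hle := Int.floor_le ((a + l - gridShift M (s + m) j) / 2 ^ s)
    rw [← hq, le_div_iff₀ hpos] at hle
    have hshift : M * gridShift M (s + m) j = j * 2 ^ m * 2 ^ s := by
      rw [gridShift, zpow_add₀ (by norm_num), zpow_natCast]
      field_simp
    push_cast
    constructor
    · nlinarith
    · nlinarith
  obtain ⟨q, h1, h2⟩ := key j h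
  obtain ⟨q', h1', h2'⟩ := key j' h'
  have e1 : (M * q + j * 2 ^ m : ℤ) < (M * q' + j' * 2 ^ m : ℤ) + 1 := by
    have : ((M * q + j * 2 ^ m : ℤ) : ℝ) * 2 ^ s <
        (((M * q' + j' * 2 ^ m : ℤ) + 1 : ℤ) : ℝ) * 2 ^ s := by
      push_cast at *
      linarith
    exact_mod_cast lt_of_mul_lt_mul_right this hpos.le
  have e2 : (M * q' + j' * 2 ^ m : ℤ) < (M * q + j * 2 ^ m : ℤ) + 1 := by
    have : ((M * q' + j' * 2 ^ m : ℤ) : ℝ) * 2 ^ s <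
        (((M * q + j * 2 ^ m : ℤ) + 1 : ℤ) : ℝ) * 2 ^ s := by
      push_cast at *
      linarith
    exact_mod_cast lt_of_mul_lt_mul_right this hpos.le
  -- Equality gives a congruence modulo `M`, in which the power of two cancels because `M` is odd.
  have hdvd : (M : ℤ) ∣ ((j : ℕ) - (j' : ℕ) : ℤ) * 2 ^ m := ⟨q' - q, by linarith⟩
  have hcop : IsCoprime (M : ℤ) (2 ^ m) := by
    refine IsCoprime.pow_right ?_
    exact_mod_cast Nat.isCoprime_iff_coprime.2 hM.coprime_two_right
  have h0 := Int.eq_zero_of_abs_lt_dvd (hcop.dvd_of_dvd_mul_right hdvd) (by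
    rw [abs_lt]
    have := j.2
    have := j'.2
    constructor <;> omega)
  ext
  omega

theorem subset_gridCell {t : ℝ} {s : ℤ} {x : Fin d → ℝ} (hu : u ⊆ hypercube a l) (hx : x ∈ u)
    (h : ∀ i, ⌊(a i - t) / 2 ^ s⌋ = ⌊(a i + l - t) / 2 ^ s⌋) : u ⊆ gridCell t s x := by
  have key : ∀ y ∈ u, ∀ i, ⌊(y i - t) / 2 ^ s⌋ = ⌊(a i - t) / 2 ^ s⌋ := by
    intro y hy i
    refine le_antisymm ?_ (Int.floor_le_floor ?_)
    · rw [h i]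
      refine Int.floor_le_floor ?_
      have := (hu hy i).2
      gcongr
    · have := (hu hy i).1
      gcongr
  intro y hy i
  rw [key y hy, key x hx]

-- A set leaves its cell only if a grid hyperplane cuts its enclosing cube, and each coordinate
-- direction rules out at most one shift.
open Classical in
theorem card_not_subset_gridCell_le {M : ℕ} (hM : Odd M) {s T : ℤ} (hs : s ≤ T)
    (hu : Bornology.IsBounded u) {x : Fin d → ℝ} (hx : x ∈ u) (hl : M * sideLength u < 2 ^ s) :
    (Finset.univ.filter fun j : Fin M => ¬ u ⊆ gridCell (gridShift M T j) s x).card ≤ d := by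
  have hM0 : (0 : ℝ) < M := by exact_mod_cast hM.pos
  rw [← lt_div_iff₀' hM0] at hl
  obtain ⟨l, hl1, hl2⟩ := exists_between hl
  rw [lt_div_iff₀' hM0] at hl2
  obtain ⟨a, ha⟩ := exists_subset_hypercube_of_sideLength_lt hu hl1
  have hex : ∀ j : Fin M, ¬ u ⊆ gridCell (gridShift M T j) s x → ∃ i,
      ⌊(a i - gridShift M T j) / 2 ^ s⌋ ≠ ⌊(a i + l - gridShift M T j) / 2 ^ s⌋ := by
    intro j hj
    by_contra! hcon
    exact hj (subset_gridCell ha hx hcon)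
  have hsub : (Finset.univ.filter fun j : Fin M => ¬ u ⊆ gridCell (gridShift M T j) s x) ⊆
      (Finset.univ : Finset (Fin d)).biUnion fun i => Finset.univ.filter fun j : Fin M =>
        ⌊(a i - gridShift M T j) / 2 ^ s⌋ ≠ ⌊(a i + l - gridShift M T j) / 2 ^ s⌋ := by
    intro j hj
    obtain ⟨i, hi⟩ := hex j (Finset.mem_filter.1 hj).2
    exact Finset.mem_biUnion.2 ⟨i, Finset.mem_univ _, Finset.mem_filter.2 ⟨Finset.mem_univ _, hi⟩⟩
  refine (Finset.card_le_card hsub).trans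
    ((Finset.card_biUnion_le_card_mul _ _ 1 fun i _ => ?_).trans (by simp))
  refine Finset.card_le_one.2 fun j hj j' hj' => ?_
  exact gridShift_inj hM hs ((sideLength_nonneg u).trans hl1.le) hl2 (Finset.mem_filter.1 hj).2
    (Finset.mem_filter.1 hj').2

/-- Every finite family of bounded sets has `2 * d + 1` systems of nested cells, such that any two
members are aligned to cells of comparable size in a common system. -/
theorem exists_aligned_cells {ι : Type*} [Finite ι] {obj : ι → Set (Fin d → ℝ)}
    (hbdd : ∀ i, Bornology.IsBounded (obj i)) :
    ∃ (γ : Fin (2 * d + 1) → ι → Set (Fin d → ℝ)) (A : Fin (2 * d + 1) → Set ι),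
      (∀ j, ∀ u ∈ A j, (obj u).Nonempty ∧ obj u ⊆ γ j u ∧ Bornology.IsBounded (γ j u) ∧
        sideLength (γ j u) ≤ (4 * d + 2 : ℕ) * sideLength (obj u)) ∧
      (∀ j, ∀ u ∈ A j, ∀ v ∈ A j, (γ j u ∩ γ j v).Nonempty →
        γ j u ⊆ γ j v ∨ γ j v ⊆ γ j u) ∧
      ∀ u v, (obj u).Nonempty → (obj v).Nonempty → ∃ j, u ∈ A j ∧ v ∈ A j := by
  classical
  set M := 2 * d + 1 with hM
  have hMpos : (0 : ℝ) < M := by rw [hM]; positivity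
  have hlevel : ∀ u, ∃ s : ℤ, 0 < sideLength (obj u) →
      (M * sideLength (obj u) < 2 ^ s ∧ (2 : ℝ) ^ s ≤ 2 * (M * sideLength (obj u))) := by
    intro u
    by_cases hu : 0 < sideLength (obj u)
    · obtain ⟨s, hs1, hs2⟩ := exists_mem_Ico_zpow (x := M * sideLength (obj u)) (y := 2)
        (by positivity) (by norm_num)
      refine ⟨s + 1, fun _ => ⟨hs2, ?_⟩⟩
      rw [zpow_add_one₀ (by norm_num)]
      linarith
    · exact ⟨0, fun h => absurd h hu⟩
  choose s hs using hlevel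
  have hpoint : ∀ u, ∃ x, (obj u).Nonempty → x ∈ obj u := fun u => by
    by_cases h : (obj u).Nonempty
    · exact ⟨h.some, fun _ => h.some_mem⟩
    · exact ⟨0, fun h' => absurd h' h⟩
  choose x hx using hpoint
  -- A common upper bound on the levels lets one set of shifts serve all of them.
  obtain ⟨T, hT⟩ : ∃ T, ∀ u, s u ≤ T := by
    obtain ⟨T, hT⟩ := (Set.finite_range s).bddAbove
    exact ⟨T, fun u => hT ⟨u, rfl⟩⟩
  -- Objects of side length zero have no level; they serve as their own cells.
  let γ : Fin M → ι → Set (Fin d → ℝ) := fun j u =>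
    if sideLength (obj u) = 0 then obj u else gridCell (gridShift M T j) (s u) (x u)
  have hpos : ∀ u, sideLength (obj u) ≠ 0 → 0 < sideLength (obj u) := fun u h =>
    lt_of_le_of_ne (sideLength_nonneg _) (Ne.symm h)
  refine ⟨γ, fun j => {u | (obj u).Nonempty ∧ obj u ⊆ γ j u}, ?_, ?_, ?_⟩
  · rintro j u ⟨hu1, hu2⟩
    refine ⟨hu1, hu2, ?_⟩
    by_cases h0 : sideLength (obj u) = 0
    · simp only [γ, h0, if_true]
      exact ⟨hbdd u, by simp⟩
    · simp only [γ, h0, if_false]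
      have hsub := gridCell_subset_hypercube (gridShift M T j) (s u) (x u)
      refine ⟨(isBounded_hypercube _ _).subset hsub, (sideLength_le (by positivity) hsub).trans ?_⟩
      refine (hs u (hpos u h0)).2.trans (le_of_eq ?_)
      rw [hM]
      push_cast
      ring
  · rintro j u ⟨_, hu⟩ v ⟨_, hv⟩ ⟨z, hzu, hzv⟩
    by_cases hu0 : sideLength (obj u) = 0
    · have hsub := subsingleton_of_sideLength_eq_zero (hbdd u) hu0
      simp only [γ, hu0, if_true] at hzu ⊢
      exact .inl fun y hy => hsub hzu hy ▸ hzv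
    by_cases hv0 : sideLength (obj v) = 0
    · have hsub := subsingleton_of_sideLength_eq_zero (hbdd v) hv0
      simp only [γ, hv0, if_true] at hzv ⊢
      exact .inr fun y hy => hsub hzv hy ▸ hzu
    simp only [γ, hu0, hv0, if_false] at hzu hzv ⊢
    rcases le_total (s u) (s v) with h | h
    · exact .inl (gridCell_subset h hzu hzv)
    · exact .inr (gridCell_subset h hzv hzu)
  · intro u v hu hv
    have hbad : ∀ u, (obj u).Nonempty →
        (Finset.univ.filter fun j : Fin M => ¬ obj u ⊆ γ j u).card ≤ d := by
      intro u hu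
      by_cases h0 : sideLength (obj u) = 0
      · simp [γ, h0]
      · simp only [γ, h0, if_false]
        exact card_not_subset_gridCell_le ⟨d, hM⟩ (hT u) (hbdd u) (hx u hu) (hs u (hpos u h0)).1
    by_contra! hcon
    -- Two objects spoil at most `2 * d` of the `2 * d + 1` shifts.
    have hcover : (Finset.univ : Finset (Fin M)) ⊆
        (Finset.univ.filter fun j : Fin M => ¬ obj u ⊆ γ j u) ∪
          (Finset.univ.filter fun j : Fin M => ¬ obj v ⊆ γ j v) := by
      intro j _
      rw [Finset.mem_union, Finset.mem_filter, Finset.mem_filter]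
      by_cases h : obj u ⊆ γ j u
      · exact .inr ⟨Finset.mem_univ _, fun h' => hcon j ⟨hu, h⟩ ⟨hv, h'⟩⟩
      · exact .inl ⟨Finset.mem_univ _, h⟩
    have h1 := (Finset.card_le_card hcover).trans (Finset.card_union_le _ _)
    have h2 := hbad u hu
    have h3 := hbad v hv
    rw [Finset.card_univ, Fintype.card_fin] at h1
    omega

end Geometry

/-! ### The forest of cells and the final assembly. -/

/-- The strict inclusion order of the cells of the members of `A`, with ties broken by the index. -/
def cellOrder {X ι : Type*} [LT ι] (γ : ι → Set X) (A : Set ι) (u v : ι) : Prop :=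
  u ∈ A ∧ v ∈ A ∧ (γ u ⊂ γ v ∨ γ u = γ v ∧ u < v)

theorem isForest_cellOrder {X ι : Type*} [LinearOrder ι] {γ : ι → Set X} {A : Set ι}
    (hne : ∀ u ∈ A, (γ u).Nonempty)
    (hγ : ∀ u ∈ A, ∀ v ∈ A, (γ u ∩ γ v).Nonempty → γ u ⊆ γ v ∨ γ v ⊆ γ u) :
    (∀ u ∈ A, ∀ v ∈ A, (γ u ∩ γ v).Nonempty →
      u = v ∨ cellOrder γ A u v ∨ cellOrder γ A v u) ∧ IsForest (cellOrder γ A) := by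
  have hsub : ∀ u v, cellOrder γ A u v → γ u ⊆ γ v := fun u v h =>
    h.2.2.elim (fun h => h.subset) fun h => h.1.subset
  have htri : ∀ u ∈ A, ∀ v ∈ A, (γ u ∩ γ v).Nonempty →
      u = v ∨ cellOrder γ A u v ∨ cellOrder γ A v u := by
    intro u hu v hv h
    by_cases heq : γ u = γ v
    · rcases lt_trichotomy u v with h1 | h1 | h1
      · exact .inr (.inl ⟨hu, hv, .inr ⟨heq, h1⟩⟩)
      · exact .inl h1
      · exact .inr (.inr ⟨hv, hu, .inr ⟨heq.symm, h1⟩⟩)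
    · rcases hγ u hu v hv h with h1 | h1
      · exact .inr (.inl ⟨hu, hv, .inl (h1.ssubset_of_ne heq)⟩)
      · exact .inr (.inr ⟨hv, hu, .inl (h1.ssubset_of_ne (Ne.symm heq))⟩)
  refine ⟨htri, fun u h => ?_, fun u v w h1 h2 => ⟨h1.1, h2.2.1, ?_⟩, fun u v w h1 h2 => ?_⟩
  · rcases h.2.2 with h | h
    · exact (ssubset_irrefl _ h)
    · exact lt_irrefl _ h.2
  · rcases h1.2.2 with h3 | h3
    · exact .inl (h3.trans_subset (hsub _ _ h2))
    · rcases h2.2.2 with h4 | h4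
      · exact .inl (h3.1 ▸ h4)
      · exact .inr ⟨h3.1.trans h4.1, h3.2.trans h4.2⟩
  · obtain ⟨x, hx⟩ := hne u h1.1
    exact htri v h1.2.1 w h2.2.1 ⟨x, hsub _ _ h1 hx, hsub _ _ h2 hx⟩

theorem Finset.exists_fin_enumeration {α : Type*} [Inhabited α] (P : Finset α) {c : ℕ}
    (h : P.card ≤ c) : ∃ f : Fin c → α, ∀ p ∈ P, ∃ i, f i = p := by
  refine ⟨fun i => if hi : (i : ℕ) < P.card then (P.equivFin.symm ⟨i, hi⟩ : α) else default,
    fun p hp => ⟨⟨P.equivFin ⟨p, hp⟩, (P.equivFin ⟨p, hp⟩).2.trans_le h⟩, ?_⟩⟩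
  simp

/-- Equality holds at `k = 1`, and the right-hand side grows faster. -/
theorem four_mul_sub_one_le (k : ℕ) (hk : 1 ≤ k) :
    ((2 * (2 * k) - 1 : ℕ) : ℝ) ≤ (11 / 9 : ℝ) * 3 ^ k - 2 / 3 := by
  have h : (4 * k - 1 : ℝ) ≤ (11 / 9 : ℝ) * 3 ^ k - 2 / 3 := by
    induction k, hk using Nat.le_induction with
    | base => norm_num
    | succ k hk ih =>
      rw [pow_succ]
      push_cast
      have : (1 : ℝ) ≤ k := by exact_mod_cast hk
      linarith
  rw [Nat.cast_sub (by omega)]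
  push_cast
  linarith

theorem mainTheorem2 (d k c : ℕ) (hk : 1 ≤ k) :
    ∃ K : ℝ, ∀ (n : ℕ) (obj : Fin n → Set (Fin d → ℝ)),
      (∀ i, Bornology.IsBounded (obj i)) → IsFat c obj →
      ∃ H : SimpleGraph (Fin n),
        IsHopSpanner ((11 / 9 : ℝ) * 3 ^ k - 2 / 3) (intersectionGraph obj) H ∧
        (H.edgeSet.ncard : ℝ) ≤ K * (n * invAck k n) := by
  classical
  obtain ⟨k, rfl⟩ : ∃ k', k = k' + 1 := ⟨k - 1, by omega⟩
  obtain ⟨C, hC, hshort⟩ := IsForest.shortcutBound_invAck k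
  set N := 4 * d + 2 with hN
  set c' := c * (2 * N + 1) ^ d + 1 with hc'
  -- Number of grids, times shortcuts per grid, times pairs stored per shortcut.
  refine ⟨(2 * d + 1 : ℕ) * (C * (1 + 3 * c' + 2 * c' ^ 2 : ℕ)), fun n obj hbdd hfat => ?_⟩
  rcases Nat.eq_zero_or_pos n with rfl | hn
  · refine ⟨⊥, ⟨bot_le, fun u => u.elim0⟩, ?_⟩
    simp
  obtain ⟨γ, A, hA, hγ, hpair⟩ := exists_aligned_cells hbdd
  have hforest := fun j => isForest_cellOrder (γ := γ j) (A := A j)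
    (fun u hu => (hA j u hu).1.mono (hA j u hu).2.1) (hγ j)
  have hsub : ∀ j u v, cellOrder (γ j) (A j) u v → γ j u ⊆ γ j v := fun j u v h =>
    h.2.2.elim (fun h => h.subset) fun h => h.1.subset
  have hhit : ∀ j u, ∃ f : Fin c' → (Fin d → ℝ), u ∈ A j →
      ∀ i, (obj i ∩ γ j u).Nonempty → sideLength (γ j u) ≤ N * sideLength (obj i) →
        ∃ q, f q ∈ obj i := by
    intro j u
    by_cases hu : u ∈ A j
    · obtain ⟨P, hP, hit⟩ := hfat.exists_hitting_set (N := N) (by omega) (hA j u hu).2.2.1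
      obtain ⟨f, hf⟩ := P.exists_fin_enumeration hP
      refine ⟨f, fun _ i h1 h2 => ?_⟩
      obtain ⟨p, hp, hpi⟩ := hit i h1 h2
      obtain ⟨q, rfl⟩ := hf p hp
      exact ⟨q, hpi⟩
    · exact ⟨0, fun h => absurd h hu⟩
  choose f hf using hhit
  choose E hEr hEcard hE using fun j => hshort (Fin n) (cellOrder (γ j) (A j)) Finset.univ n
    (hforest j).2 (fun _ _ _ => ⟨Finset.mem_univ _, Finset.mem_univ _⟩) (by exact_mod_cast hn)
    (fun y => by
      have : (Finset.univ.filter fun x => cellOrder (γ j) (A j) x y).card <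
          (Finset.univ : Finset (Fin n)).card := by
        refine Finset.card_lt_card (Finset.filter_ssubset.2 ⟨y, Finset.mem_univ _, ?_⟩)
        exact (hforest j).2.irrefl y
      rw [Finset.card_univ, Fintype.card_fin] at this
      exact_mod_cast this)
  set G := intersectionGraph obj with hG
  let Kl : Fin (2 * d + 1) → Fin n → Fin c' → Set (Fin n) := fun j u q => {v | f j u q ∈ obj v}
  let Q := Finset.univ.biUnion fun j => (E j).biUnion fun p => spannerPairs G (Kl j) p.1 p.2
  have hKl : ∀ j z q, ∀ a ∈ Kl j z q, ∀ b ∈ Kl j z q, a = b ∨ G.Adj a b := by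
    intro j z q a ha b hb
    by_cases hab : a = b
    · exact .inl hab
    · exact .inr ⟨hab, _, ha, hb⟩
  have hreach : ∀ j u v, G.Adj u v → cellOrder (γ j) (A j) u v →
      HopReach (pairGraph G Q).Adj (2 * (2 * (k + 1)) - 1) u v := by
    intro j u v hadj huv
    refine hopReach_of_shortcuts (hforest j).2 (hEr j) (hKl j) (fun z huz hzv => ?_)
      (fun p hp => ?_) (hE j u v huv) huv hadj
    -- `v` meets the cell of `z` where it meets `u`, whose cell is contained in that of `z`; and `v`
    -- is large enough because the cell of `z` is contained in its own.
    · refine hf j z hzv.1 v ?_ ?_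
      · obtain ⟨x, hxu, hxv⟩ := hadj.2
        exact ⟨x, hxv, hsub j u z huz ((hA j u huv.1).2.1 hxu)⟩
      · have hv := hA j v huv.2.1
        exact (sideLength_mono hv.2.2.1 (hsub j z v hzv)).trans hv.2.2.2
    · exact (Finset.subset_biUnion_of_mem
        (fun p : Fin n × Fin n => spannerPairs G (Kl j) p.1 p.2) hp).trans
        (Finset.subset_biUnion_of_mem
          (fun j => (E j).biUnion fun p => spannerPairs G (Kl j) p.1 p.2) (Finset.mem_univ j))
  have hpath : ∀ u v, G.Adj u v → ∃ p : (pairGraph G Q).Walk u v,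
      p.length ≤ 2 * (2 * (k + 1)) - 1 := by
    intro u v hadj
    obtain ⟨x, hxu, hxv⟩ := hadj.2
    obtain ⟨j, hu, hv⟩ := hpair u v ⟨x, hxu⟩ ⟨x, hxv⟩
    rcases (hforest j).1 u hu v hv ⟨x, (hA j u hu).2.1 hxu, (hA j v hv).2.1 hxv⟩ with h | h | h
    · exact absurd h hadj.1
    · exact (hreach j u v hadj h).exists_walk
    · obtain ⟨p, hp⟩ := (hreach j v u hadj.symm h).exists_walk
      exact ⟨p.reverse, by simpa using hp⟩
  refine ⟨pairGraph G Q, ⟨fun a b h => h.1, fun u v hadj => ?_⟩, ?_⟩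
  · obtain ⟨p, hp⟩ := hpath u v hadj
    refine ⟨p.bypass, p.bypass_isPath, le_trans ?_ (four_mul_sub_one_le (k + 1) hk)⟩
    exact_mod_cast p.length_bypass_le_length.trans hp
  · set B := 1 + 3 * c' + 2 * c' ^ 2 with hB
    have h1 : Q.card ≤ ∑ j, (E j).card * B := by
      refine Finset.card_biUnion_le.trans (Finset.sum_le_sum fun j _ => ?_)
      exact Finset.card_biUnion_le_card_mul _ _ _ fun p _ => card_spannerPairs_le _ _ _ _
    have h2 : ((pairGraph G Q).edgeSet.ncard : ℝ) ≤ ∑ j, ((E j).card : ℝ) * B := by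
      exact_mod_cast (ncard_edgeSet_pairGraph_le G Q).trans h1
    refine h2.trans ?_
    calc ∑ j, ((E j).card : ℝ) * B
        ≤ ∑ _j : Fin (2 * d + 1), C * (n * invAck (k + 1) n) * B := by
          refine Finset.sum_le_sum fun j _ => ?_
          have := hEcard j
          rw [Finset.card_univ, Fintype.card_fin] at this
          gcongr
      _ = _ := by
          rw [Finset.sum_const, Finset.card_univ, Fintype.card_fin, nsmul_eq_mul]
          ring
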